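/- **Notation.** Let $d\ge 0$, $N\ge 1$, $M\ge 1$ be integers, let $\mathbb K=\mathbb R$ or $\mathbb C$, and let $\Omega=c\,dx_1\wedge\dots\wedge dx_d$, $c\in\mathbb R\setminus\{0\}$, be a constant volume form on $\mathbb R^d$. Let $T_{\rm poly}=\bigoplus_k T_{\rm poly}^{k-1}$, where $T_{\rm poly}^{k-1}$ is the space of smooth $\mathbb K$-valued $k$-vector fields, seen as skew-symmetric contravariant tensors $\gamma^{i_1\cdots i_k}=\gamma(dx^{i_1},\dots,dx^{i_k})$. The divergence is the de Rham differential transported by the isomorphism $\gamma\mapsto\iota_\gamma\Omega$ from $k$-vector fields to $(d-k)$-forms; thus $\operatorname{div}\gamma=0$ iff $d(\iota_{\gamma}\Omega)=0$ in each degree. *Graphs.* $G_{N,M}$ is the set of oriented graphs $\Gamma$ with $N$ vertices of the first type, $M$ vertices of the second type and $2N+M-3$ edges, without loops or multiple edges, such that every edge starts at a vertex of the first type and the set ${\rm Star}(k)$ of the edges that start at $k$ is labelled as $e_k^1,\dots,e_k^{s_k}$, $s_k=\#{\rm Star}(k)$, for each vertex $k$ of the first type. *Operators.* For $\Gamma\in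 G_{N,M}$, $\gamma_1,\dots,\gamma_N\in T_{\rm poly}$ and smooth functions $f_1,\dots,f_M:\mathbb R^d\to\mathbb K$, $$\mathcal U_\Gamma(\gamma_1\otimes\cdots\otimes\gamma_N)(f_1\otimes\cdots\otimes f_M)=\sum_{I:E_\Gamma\to\{1,\dots,d\}}\ \prod_{k=1}^N\Big(\prod_{e=(\cdot,k)}\partial_{I(e)}\Big)\gamma_k^{I(e_k^1)\cdots I(e_k^{s_k})}\ \prod_{j=1}^M\Big(\prod_{e=(\cdot,\bar j)}\partial_{I(e)}\Big)f_j ,$$ and $\widetilde{\mathcal U}_\Gamma(\gamma_1\wedge\dots\wedge\gamma_N)=\frac1{N!}\sum_{\sigma\in S_N}\varepsilon(\sigma)\,\mathcal U_\Gamma(\gamma_{\sigma(1)}\otimes\dots\otimes\gamma_{\sigma(N)})$, where $\varepsilon(\sigma)=\prod_{i<j,\ \sigma(i)>\sigma(j)}(-1)^{s_is_j}$ (skew-symmetrization in the graded sense $\bigwedge^N T_{\rm poly}\cong {\rm Sym}^N(T_{\rm poly}[1])[-N]$). *Angle forms.* Let $D$ be the closed unit disk with the Poincaré metric in its interior. For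 $p\in{\rm Int}\,D$, $q\in D\setminus\{p\}$ and $\xi\in\partial D$, let $\phi(p,q;\xi)\in\mathbb R/2\pi\mathbb Z$ be the angle at $p$, counted counterclockwise, from the geodesic joining $p$ to $\xi$ to the geodesic joining $p$ to $q$. Consider configurations of distinct points $p_1,\dots,p_N\in{\rm Int}\,D$ and distinct points $q_1,\dots,q_M\in\partial D$. The group ${\rm PSL}_2(\mathbb R)$ acts on these freely by the holomorphic automorphisms of the disk; let $D^+_{N,M}$ be the $(2N+M-3)$-dimensional quotient of the set of the configurations for which $q_1,\dots,q_M$ are cyclically ordered counterclockwise. For $\alpha=(\alpha_1,\dots,\alpha_M)\in\mathbb R^M$ and an edge $e$ of $\Gamma$, the 1-form $d\phi_{e;\alpha}=\sum_{j=1}^M\alpha_j\,d\phi(p,q;q_j)$, where $p$ and $q$ are the positions of the start and the end of $e$, is well defined and descends to $D^+_{N,M}$. *Weights.* Order the edges lexicographically and orient $D^+_{N,M}$ by the coordinates $\operatorname{Re}p_2,\operatorname{Im}p_2,\dots,\operatorname{Re}p_N,\operatorname{Im}p_N,\arg q_2,\dots,\arg q_M$ in the gauge $p_1=0$, $q_1=1$.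 Put $$W_\Gamma^{\alpha}=\prod_{k=1}^N\frac1{s_k!}\cdot\frac1{(2\pi)^{2N+M-2}}\int_{D^+_{N,M}}\bigwedge_{e\in E_\Gamma}d\phi_{e;\alpha},\qquad \widetilde{\mathcal U}^{\alpha}_N(\gamma_1\wedge\cdots\wedge\gamma_N)(f_1\otimes\cdots\otimes f_M)=\sum_{\Gamma\in G_{N,M}}W^{\alpha}_\Gamma\,\widetilde{\mathcal U}_\Gamma(\gamma_1\wedge\cdots\wedge\gamma_N)(f_1\otimes\cdots\otimes f_M).$$ **Theorem.** Let $\gamma_1,\dots,\gamma_N\in T_{\rm poly}$ satisfy $\operatorname{div}\gamma_1=\dots=\operatorname{div}\gamma_N=0$, and let $f_1,\dots,f_M:\mathbb R^d\to\mathbb K$ be smooth functions with compact support. Then, for every $\alpha\in\mathbb R^M$, all the integrals $W_\Gamma^\alpha$ converge absolutely, the function $\widetilde{\mathcal U}^{\alpha}_N(\gamma_1\wedge\cdots\wedge\gamma_N)(f_1\otimes\cdots\otimes f_M)$ is integrable on $\mathbb R^d$, and $$\int_{\mathbb R^d}\widetilde{\mathcal U}^{\alpha_1,\dots,\alpha_M}_N(\gamma_1\wedge\cdots\wedge\gamma_N)(f_1\otimes\cdots\otimes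 f_M)\cdot\Omega$$ depends only on the sum $\alpha_1+\dots+\alpha_M$. -/

import Mathlib

open scoped ContDiff

noncomputable section

namespace CyclicFormality

/-! ### Polyvector fields, the volume form and the divergence -/

/-- The graded space of smooth polyvector fields on `ℝ^d` with coefficients in `𝕜` (`ℝ` or `ℂ`).
An element is given by its homogeneous components: `comp k` is the component of polyvector degree
`k`, a smooth field of alternating `k`-forms on the dual of `ℝ^d`. The components with `k > d`
vanish automatically. A polyvector `ξ₁ ∧ ⋯ ∧ ξₖ` is the alternating form
`(λ₁, …, λₖ) ↦ det (λₐ ξ_b)`. -/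
structure Polyvector (d : ℕ) (𝕜 : Type*) [RCLike 𝕜] where
  comp : (k : ℕ) → (Fin d → ℝ) → ((Fin d → ℝ) →L[ℝ] ℝ) [⋀^Fin k]→L[ℝ] 𝕜
  smooth : ∀ k, ContDiff ℝ ∞ (comp k)

/-- The coordinate vector `e_i = ∂/∂x_i`. -/
def coordVector {d : ℕ} (i : Fin d) : Fin d → ℝ := Pi.single i 1

/-- The coordinate covector `dx^i`. -/
def coordCovector {d : ℕ} (i : Fin d) : (Fin d → ℝ) →L[ℝ] ℝ :=
  ContinuousLinearMap.proj i

/-- `insertVectors k v η = η (v 0, …, v (k-1), ⬝, …, ⬝)`. -/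
def insertVectors {E F : Type*} [NormedAddCommGroup E] [NormedSpace ℝ E]
    [NormedAddCommGroup F] [NormedSpace ℝ F] {l : ℕ} :
    (k : ℕ) → (Fin k → E) → E [⋀^Fin (l + k)]→L[ℝ] F → E [⋀^Fin l]→L[ℝ] F
  | 0, _, η => η
  | k + 1, v, η => insertVectors k (Fin.tail v) (η.curryLeft (v 0))

/-- The contraction of the form `Ω` of degree `l + k` with a `k`-vector `P`:
`(1 / k!) ∑_I P(dx^{I_1}, …, dx^{I_k}) Ω(e_{I_1}, …, e_{I_k}, ⬝, …, ⬝)`. -/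
def contract {d : ℕ} {𝕜 : Type*} [RCLike 𝕜] {k l : ℕ}
    (P : ((Fin d → ℝ) →L[ℝ] ℝ) [⋀^Fin k]→L[ℝ] 𝕜)
    (Ω : (Fin d → ℝ) [⋀^Fin (l + k)]→L[ℝ] ℝ) : (Fin d → ℝ) [⋀^Fin l]→L[ℝ] 𝕜 :=
  ((k.factorial : ℝ)⁻¹) • ∑ I : Fin k → Fin d,
    P (fun a => coordCovector (I a)) •
      (RCLike.ofRealCLM (K := 𝕜)).compContinuousAlternatingMap
        (insertVectors k (fun a => coordVector (I a)) Ω)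

/-- A `d`-form as a form of degree `l + k = d`. -/
def castForm {E F : Type*} [NormedAddCommGroup E] [NormedSpace ℝ E]
    [NormedAddCommGroup F] [NormedSpace ℝ F] {d e : ℕ} (h : d = e) (η : E [⋀^Fin d]→L[ℝ] F) :
    E [⋀^Fin e]→L[ℝ] F :=
  h ▸ η

/-- `div γ = 0` with respect to the constant volume form `Ω`. The divergence is the de Rham
differential transported to polyvector fields by the isomorphism `P ↦ contract P Ω`, so it
vanishes exactly when the form `contract γ Ω` is closed in each degree. -/
def Polyvector.IsDivFree {d : ℕ} {𝕜 : Type*} [RCLike 𝕜] (γ : Polyvector d 𝕜)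
    (Ω : (Fin d → ℝ) [⋀^Fin d]→L[ℝ] ℝ) : Prop :=
  ∀ (k l : ℕ) (h : d = l + k) (x : Fin d → ℝ),
    extDeriv (fun y => contract (γ.comp k y) (castForm h Ω)) x = 0

/-- `∫ g · Ω` over `ℝ^d` with its standard orientation, for a constant form `Ω`. -/
def integralForm {d : ℕ} {𝕜 : Type*} [RCLike 𝕜] (Ω : (Fin d → ℝ) [⋀^Fin d]→L[ℝ] ℝ)
    (g : (Fin d → ℝ) → 𝕜) : 𝕜 :=
  ((Ω (fun i => coordVector i) : ℝ) : 𝕜) * ∫ x, g x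

/-! ### Admissible graphs and their polydifferential operators -/

/-- A labelled admissible graph in `G_{n,m}`: `n` vertices of the first type (`Sum.inl`), `m`
vertices of the second type (`Sum.inr`). The edges that start at the vertex `k` of the first type
are labelled by `Fin (star k)`, and `target k a` is the end point of the edge with label `a`. There
are no loops, no multiple edges, and exactly `2 n + m - 3` edges. -/
@[ext] structure AdmissibleGraph (n m : ℕ) where
  star : Fin n → ℕ
  target : (k : Fin n) → Fin (star k) → Fin n ⊕ Fin m
  target_ne : ∀ k a, target k a ≠ Sum.inl k
  target_injective : ∀ k, Function.Injective (target k)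
  card_edges : ∑ k, star k + 3 = 2 * n + m

namespace AdmissibleGraph

variable {n m : ℕ}

instance : Finite (AdmissibleGraph n m) := by
  have hb : ∀ (Γ : AdmissibleGraph n m) (k : Fin n), Γ.star k < 2 * n + m := by
    intro Γ k
    have h1 : Γ.star k ≤ ∑ k, Γ.star k :=
      Finset.single_le_sum (f := Γ.star) (fun _ _ => Nat.zero_le _) (Finset.mem_univ k)
    have h2 := Γ.card_edges
    omega
  let F : AdmissibleGraph n m →
      Σ s : Fin n → Fin (2 * n + m), ((k : Fin n) → Fin (s k) → Fin n ⊕ Fin m) :=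
    fun Γ => ⟨fun k => ⟨Γ.star k, hb Γ k⟩, Γ.target⟩
  refine Finite.of_injective F ?_
  rintro ⟨s, t, h1, h2, h3⟩ ⟨s', t', h1', h2', h3'⟩ h
  have hs : s = s' := by
    funext k
    have := congrFun (congrArg Sigma.fst h) k
    exact congrArg Fin.val this
  subst hs
  have ht : t = t' := eq_of_heq (Sigma.mk.inj h).2
  subst ht
  rfl

instance : Fintype (AdmissibleGraph n m) := Fintype.ofFinite _

/-- The edges: pairs of a starting vertex and a label. -/
abbrev Edge (Γ : AdmissibleGraph n m) : Type := Σ k : Fin n, Fin (Γ.star k)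

/-- The list of edges in lexicographic order. -/
def edgeList (Γ : AdmissibleGraph n m) : List Γ.Edge :=
  (List.finRange n).flatMap fun k => (List.finRange (Γ.star k)).map fun a => ⟨k, a⟩

/-- The list of edges that end at `v`. -/
def incoming (Γ : AdmissibleGraph n m) (v : Fin n ⊕ Fin m) : List Γ.Edge :=
  Γ.edgeList.filter fun e => Γ.target e.1 e.2 = v

end AdmissibleGraph

/-- The iterated partial derivative `∂_{i_1} ⋯ ∂_{i_r} g` for a list `[i_1, …, i_r]`. -/
def iterPartial {d : ℕ} {𝕜 : Type*} [RCLike 𝕜] (L : List (Fin d)) (g : (Fin d → ℝ) → 𝕜) :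
    (Fin d → ℝ) → 𝕜 :=
  L.foldr (fun i h x => fderiv ℝ h x (coordVector i)) g

/-- The polydifferential operator of a graph,
`U_Γ(γ_1 ⊗ ⋯ ⊗ γ_n)(f_1 ⊗ ⋯ ⊗ f_m) = ∑_I ∏_k (∏_{e = (⬝,k)} ∂_{I(e)}) γ_k^{I(e_k^1) ⋯ I(e_k^{s_k})}
 ∏_j (∏_{e = (⬝,j)} ∂_{I(e)}) f_j`, with `I` ranging over all maps from the edges to
`{1, …, d}`. Only the component of `γ_k` of degree `s_k = #Star(k)` contributes. -/
def graphOperator {d n m : ℕ} {𝕜 : Type*} [RCLike 𝕜] (Γ : AdmissibleGraph n m)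
    (γ : Fin n → Polyvector d 𝕜) (f : Fin m → (Fin d → ℝ) → 𝕜) (x : Fin d → ℝ) : 𝕜 :=
  ∑ I : Γ.Edge → Fin d,
    (∏ k, iterPartial ((Γ.incoming (Sum.inl k)).map I)
        (fun y => (γ k).comp (Γ.star k) y (fun a => coordCovector (I ⟨k, a⟩))) x) *
      ∏ j, iterPartial ((Γ.incoming (Sum.inr j)).map I) (f j) x

/-- The Koszul sign of a permutation of `n` homogeneous elements, the one placed at position `i`
having parity `s i`. -/
def koszulSign {n : ℕ} (s : Fin n → ℕ) (σ : Equiv.Perm (Fin n)) : ℤ :=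
  ∏ i, ∏ j, if i < j ∧ σ j < σ i then (-1) ^ (s i * s j) else 1

/-- The skew-symmetrization of `graphOperator Γ`. The exterior power of the polyvector fields is
taken in the graded sense, `⋀^n T ≅ Sym^n(T[1])[-n]` where a `k`-vector field has degree `k - 1` in
`T`; so the sign is the Koszul sign for the polyvector degrees. -/
def skewGraphOperator {d n m : ℕ} {𝕜 : Type*} [RCLike 𝕜] (Γ : AdmissibleGraph n m)
    (γ : Fin n → Polyvector d 𝕜) (f : Fin m → (Fin d → ℝ) → 𝕜) (x : Fin d → ℝ) : 𝕜 :=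
  ((n.factorial : 𝕜)⁻¹) * ∑ σ : Equiv.Perm (Fin n),
    (koszulSign Γ.star σ : 𝕜) * graphOperator Γ (fun i => γ (σ i)) f x

/-! ### Configurations in the disk modulo `PSL₂(ℝ)` -/

/-- The elements of `PSL₂(ℝ)`, acting on the closed unit disk:
`z ↦ u (z - a) / (1 - \bar a z)` with `|u| = 1` and `|a| < 1`. -/
def diskMobius (u a z : ℂ) : ℂ := u * ((z - a) / (1 - (starRingEnd ℂ) a * z))

/-- The configurations of `n` distinct points in the open unit disk and `m` distinct points on the
unit circle that are cyclically ordered counterclockwise. -/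
def OrderedConf (n m : ℕ) : Set ((Fin n → ℂ) × (Fin m → ℂ)) :=
  {c | (∀ i, ‖c.1 i‖ < 1) ∧ Function.Injective c.1 ∧
    ∃ θ : Fin m → ℝ, StrictMono θ ∧ (∀ i j, θ j - θ i < 2 * Real.pi) ∧
      ∀ j, c.2 j = Complex.exp (θ j * Complex.I)}

/-- Two configurations lie in the same `PSL₂(ℝ)`-orbit. -/
def SameOrbit {n m : ℕ} (c c' : (Fin n → ℂ) × (Fin m → ℂ)) : Prop :=
  ∃ u a : ℂ, ‖u‖ = 1 ∧ ‖a‖ < 1 ∧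
    (∀ i, c'.1 i = diskMobius u a (c.1 i)) ∧ ∀ j, c'.2 j = diskMobius u a (c.2 j)

/-- Real coordinates on the quotient of `OrderedConf (n+1) (m+1)` by `PSL₂(ℝ)`: by the action, the
first interior point is moved to `0` and the first boundary point to `1`; the coordinates are the
remaining interior points `w` and the arguments `t` of the remaining boundary points. -/
abbrev SliceCoord (n m : ℕ) : Type := (Fin n → ℂ) × (Fin m → ℝ)

/-- The interior points `0, w_1, …, w_n`. -/
def sliceInt {n m : ℕ} (y : SliceCoord n m) (i : Fin (n + 1)) : ℂ :=
  Fin.cons (α := fun _ => ℂ) 0 y.1 i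

/-- The arguments `0, t_1, …, t_m` of the boundary points. -/
def sliceArg {n m : ℕ} (y : SliceCoord n m) (j : Fin (m + 1)) : ℝ :=
  Fin.cons (α := fun _ => ℝ) 0 y.2 j

/-- The boundary points `1, exp(i t_1), …, exp(i t_m)`. -/
def sliceBdry {n m : ℕ} (y : SliceCoord n m) (j : Fin (m + 1)) : ℂ :=
  Complex.exp (sliceArg y j * Complex.I)

/-- The domain of the coordinates: `w_1, …, w_n` are distinct non-zero points of the open unit disk
and `0 < t_1 < ⋯ < t_m < 2π`. -/
def sliceDomain (n m : ℕ) : Set (SliceCoord n m) :=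
  {y | (∀ i, ‖sliceInt y i‖ < 1) ∧ Function.Injective (sliceInt y) ∧
    StrictMono (sliceArg y) ∧ ∀ j, sliceArg y j < 2 * Real.pi}

theorem one_sub_ne_zero {a z : ℂ} (ha : ‖a‖ < 1) (hz : ‖z‖ ≤ 1) :
    1 - (starRingEnd ℂ) a * z ≠ 0 := by
  intro h
  have h1 : (starRingEnd ℂ) a * z = 1 := (sub_eq_zero.mp h).symm
  have h2 : ‖a‖ * ‖z‖ = 1 := by
    have := congrArg norm h1
    simpa using this
  nlinarith [norm_nonneg a, norm_nonneg z]

theorem norm_diskMobius_lt {u a z : ℂ} (hu : ‖u‖ = 1) (ha : ‖a‖ < 1) (hz : ‖z‖ < 1) :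
    ‖diskMobius u a z‖ < 1 := by
  have h0 := one_sub_ne_zero ha hz.le
  rw [diskMobius, norm_mul, hu, one_mul, norm_div, div_lt_one (norm_pos_iff.mpr h0)]
  have ha2 : ‖a‖ ^ 2 < 1 := by nlinarith [norm_nonneg a]
  have hz2 : ‖z‖ ^ 2 < 1 := by nlinarith [norm_nonneg z]
  refine lt_of_pow_lt_pow_left₀ 2 (norm_nonneg _) ?_
  have key : ‖1 - (starRingEnd ℂ) a * z‖ ^ 2 - ‖z - a‖ ^ 2 = (1 - ‖a‖ ^ 2) * (1 - ‖z‖ ^ 2) := by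
    simp only [Complex.sq_norm, Complex.normSq_apply, Complex.sub_re, Complex.sub_im,
      Complex.mul_re, Complex.mul_im, Complex.conj_re, Complex.conj_im, Complex.one_re,
      Complex.one_im]
    ring
  nlinarith [mul_pos (sub_pos.mpr ha2) (sub_pos.mpr hz2)]

theorem diskMobius_injective {u a z w : ℂ} (hu : ‖u‖ = 1) (ha : ‖a‖ < 1) (hz : ‖z‖ < 1)
    (hw : ‖w‖ < 1) (h : diskMobius u a z = diskMobius u a w) : z = w := by
  have hu0 : u ≠ 0 := by
    rintro rfl
    simp at hu
  have h1 := mul_left_cancel₀ hu0 h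
  rw [div_eq_div_iff (one_sub_ne_zero ha hz.le) (one_sub_ne_zero ha hw.le)] at h1
  have h2 : (z - w) * (1 - (starRingEnd ℂ) a * a) = 0 := by linear_combination h1
  rcases mul_eq_zero.mp h2 with h3 | h3
  · exact sub_eq_zero.mp h3
  · exact absurd h3 (one_sub_ne_zero ha ha.le)

/-- A lift to the real line of the action of `diskMobius 1 a` on the unit circle. -/
def circleLift (a : ℂ) (θ : ℝ) : ℝ :=
  θ - 2 * (Complex.log (1 - (starRingEnd ℂ) a * Complex.exp (θ * Complex.I))).im

theorem circleLift_add (a : ℂ) (θ : ℝ) :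
    circleLift a (θ + 2 * Real.pi) = circleLift a θ + 2 * Real.pi := by
  have h : Complex.exp (((θ + 2 * Real.pi : ℝ) : ℂ) * Complex.I) =
      Complex.exp (θ * Complex.I) := by
    push_cast
    rw [add_mul, Complex.exp_add, Complex.exp_two_pi_mul_I, mul_one]
  rw [circleLift, circleLift, h]
  ring

theorem exp_circleLift {a : ℂ} (ha : ‖a‖ < 1) (θ : ℝ) :
    Complex.exp (circleLift a θ * Complex.I) =
      diskMobius 1 a (Complex.exp (θ * Complex.I)) := by
  set e := Complex.exp (θ * Complex.I) with he
  have hn : ‖e‖ = 1 := Complex.norm_exp_ofReal_mul_I θ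
  have h0 : 1 - (starRingEnd ℂ) a * e ≠ 0 := one_sub_ne_zero ha hn.le
  set w := 1 - (starRingEnd ℂ) a * e with hw
  have hee : e * (starRingEnd ℂ) e = 1 := by
    rw [Complex.mul_conj, Complex.normSq_eq_norm_sq, hn]
    simp
  have h1 : ((circleLift a θ : ℝ) : ℂ) * Complex.I =
      θ * Complex.I + ((starRingEnd ℂ) (Complex.log w) - Complex.log w) := by
    have : (starRingEnd ℂ) (Complex.log w) - Complex.log w =
        - (2 * ((Complex.log w).im : ℂ) * Complex.I) := by
      apply Complex.ext
      · simp
      · simp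
        ring
    rw [this, circleLift]
    push_cast
    ring
  rw [h1, Complex.exp_add, Complex.exp_sub, Complex.exp_conj, Complex.exp_log h0, ← he]
  have h2 : (starRingEnd ℂ) w = 1 - a * (starRingEnd ℂ) e := by
    rw [hw]
    simp
  rw [h2, diskMobius, one_mul, ← hw, mul_div_assoc']
  congr 1
  linear_combination (-a) * hee

theorem circleLift_strictMono {a : ℂ} (ha : ‖a‖ < 1) : StrictMono (circleLift a) := by
  have hd : ∀ θ : ℝ, HasDerivAt (circleLift a)
      (1 - 2 * (-((starRingEnd ℂ) a * (Complex.exp (θ * Complex.I) * Complex.I)) /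
        (1 - (starRingEnd ℂ) a * Complex.exp (θ * Complex.I))).im) θ := by
    intro θ
    have h1 : HasDerivAt (fun t : ℝ => Complex.exp (t * Complex.I))
        (Complex.exp (θ * Complex.I) * Complex.I) θ := by
      have h : HasDerivAt (fun t : ℝ => (t : ℂ) * Complex.I) Complex.I θ := by
        simpa using (Complex.ofRealCLM.hasDerivAt (x := θ)).mul_const Complex.I
      exact h.cexp
    have h2 := (h1.const_mul ((starRingEnd ℂ) a)).const_sub 1
    have hre : 1 - (starRingEnd ℂ) a * Complex.exp (θ * Complex.I) ∈ Complex.slitPlane := by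
      left
      have h3 : ((starRingEnd ℂ) a * Complex.exp (θ * Complex.I)).re < 1 := by
        refine (Complex.re_le_norm _).trans_lt ?_
        rw [norm_mul, Complex.norm_exp_ofReal_mul_I]
        simpa using ha
      rw [Complex.sub_re, Complex.one_re]
      linarith
    have h3 := h2.clog_real hre
    have h4 : HasDerivAt (fun t : ℝ => (Complex.log (1 - (starRingEnd ℂ) a *
        Complex.exp (t * Complex.I))).im) _ θ :=
      Complex.imCLM.hasFDerivAt.comp_hasDerivAt θ h3
    exact (hasDerivAt_id θ).sub (h4.const_mul 2)
  refine strictMono_of_deriv_pos fun θ => ?_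
  rw [(hd θ).deriv]
  set e := Complex.exp (θ * Complex.I) with he
  have hn : ‖e‖ = 1 := Complex.norm_exp_ofReal_mul_I θ
  have h0 : 1 - (starRingEnd ℂ) a * e ≠ 0 := one_sub_ne_zero ha hn.le
  set b := (starRingEnd ℂ) a * e with hb
  have hbn : ‖b‖ < 1 := by
    rw [hb, norm_mul, hn]
    simpa using ha
  have hb2 : Complex.normSq b < 1 := by
    rw [Complex.normSq_eq_norm_sq]
    nlinarith [norm_nonneg b]
  have hpos : 0 < Complex.normSq (1 - b) := Complex.normSq_pos.mpr h0
  have heq : (-((starRingEnd ℂ) a * (e * Complex.I)) / (1 - b)).im =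
      (Complex.normSq b - b.re) / Complex.normSq (1 - b) := by
    have : (starRingEnd ℂ) a * (e * Complex.I) = b * Complex.I := by rw [hb, mul_assoc]
    rw [this, Complex.div_im]
    simp [Complex.normSq_apply]
    field_simp
    ring
  rw [heq, sub_pos, mul_div_assoc', div_lt_one hpos]
  simp only [Complex.normSq_apply, Complex.sub_re, Complex.sub_im, Complex.one_re,
    Complex.one_im] at hb2 ⊢
  nlinarith

/-- The coordinates are faithful: every `PSL₂(ℝ)`-orbit in `OrderedConf (n+1) (m+1)` contains
exactly one configuration of the form `(0, w; 1, exp(i t))` with `(w, t)` in `sliceDomain n m`. -/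
theorem existsUnique_slice {n m : ℕ} {c : (Fin (n + 1) → ℂ) × (Fin (m + 1) → ℂ)}
    (hc : c ∈ OrderedConf (n + 1) (m + 1)) :
    ∃! y : SliceCoord n m, y ∈ sliceDomain n m ∧ SameOrbit c (sliceInt y, sliceBdry y) := by
  obtain ⟨hin, hinj, θ, hmono, hlt, hq⟩ := hc
  have ha := hin 0
  set a := c.1 0 with ha_def
  set u : ℂ := Complex.exp ((-circleLift a (θ 0) : ℝ) * Complex.I) with hu_def
  have hu : ‖u‖ = 1 := Complex.norm_exp_ofReal_mul_I _
  have hbd : ∀ j, diskMobius u a (c.2 j) =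
      Complex.exp ((circleLift a (θ j) - circleLift a (θ 0) : ℝ) * Complex.I) := by
    intro j
    have h := exp_circleLift ha (θ j)
    rw [diskMobius, one_mul] at h
    rw [diskMobius, hq j, ← h, hu_def, ← Complex.exp_add]
    congr 1
    push_cast
    ring
  have hzero : diskMobius u a (c.1 0) = 0 := by simp [diskMobius, ha_def]
  let y : SliceCoord n m := (fun i => diskMobius u a (c.1 i.succ),
    fun j => circleLift a (θ j.succ) - circleLift a (θ 0))
  have hI : ∀ i, sliceInt y i = diskMobius u a (c.1 i) := by
    intro i
    refine Fin.cases ?_ (fun i => ?_) i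
    · rw [hzero]
      rfl
    · rfl
  have hA : ∀ j, sliceArg y j = circleLift a (θ j) - circleLift a (θ 0) := by
    intro j
    refine Fin.cases ?_ (fun j => ?_) j
    · rw [sub_self]
      rfl
    · rfl
  refine ⟨y, ⟨⟨fun i => ?_, fun i j hij => ?_, fun i j hij => ?_, fun j => ?_⟩,
    u, a, hu, ha, hI, fun j => ?_⟩, ?_⟩
  · rw [hI]
    exact norm_diskMobius_lt hu ha (hin i)
  · rw [hI, hI] at hij
    exact hinj (diskMobius_injective hu ha (hin i) (hin j) hij)
  · rw [hA, hA]
    exact sub_lt_sub_right (circleLift_strictMono ha (hmono hij)) _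
  · rw [hA]
    have h1 : θ j < θ 0 + 2 * Real.pi := by linarith [hlt 0 j]
    have h2 := circleLift_strictMono ha h1
    rw [circleLift_add] at h2
    linarith
  · change sliceBdry y j = _
    rw [hbd, sliceBdry, hA]
  · rintro z ⟨⟨-, -, hzm, hzl⟩, v, b, hv, hb, hzI, hzB⟩
    have hv0 : v ≠ 0 := by
      rintro rfl
      simp at hv
    have hab : a = b := by
      have h : (0 : ℂ) = diskMobius v b a := hzI 0
      have h1 := (mul_eq_zero.mp h.symm).resolve_left hv0
      have h2 := (div_eq_zero_iff.mp h1).resolve_right (one_sub_ne_zero hb ha.le)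
      exact sub_eq_zero.mp h2
    subst hab
    have huv : v = u := by
      have h : sliceBdry z 0 = diskMobius v a (c.2 0) := hzB 0
      have h1 : sliceBdry z 0 = 1 := by simp [sliceBdry, sliceArg]
      have h2 := hbd 0
      rw [sub_self, Complex.ofReal_zero, zero_mul, Complex.exp_zero] at h2
      rw [h1, ← h2, diskMobius, diskMobius] at h
      have h3 : (c.2 0 - a) / (1 - (starRingEnd ℂ) a * c.2 0) ≠ 0 := by
        intro h4
        rw [diskMobius, h4, mul_zero] at h2
        exact zero_ne_one h2
      exact (mul_right_cancel₀ h3 h).symm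
    subst huv
    apply Prod.ext
    · funext i
      exact hzI i.succ
    · funext j
      have h : sliceBdry z j.succ = diskMobius u a (c.2 j.succ) := hzB j.succ
      rw [hbd, ← hA, sliceBdry] at h
      have hy0 : 0 < sliceArg y j.succ := by
        rw [hA]
        exact sub_pos.mpr (circleLift_strictMono ha (hmono (Fin.succ_pos j)))
      have hy1 : sliceArg y j.succ < 2 * Real.pi := by
        rw [hA]
        have h1 : θ j.succ < θ 0 + 2 * Real.pi := by linarith [hlt 0 j.succ]
        have h2 := circleLift_strictMono ha h1
        rw [circleLift_add] at h2
        linarith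
      have hz0 : 0 < sliceArg z j.succ := hzm (Fin.succ_pos j)
      have hz1 := hzl j.succ
      obtain ⟨k, hk⟩ := Complex.exp_eq_exp_iff_exists_int.mp h
      have hk' : sliceArg z j.succ = sliceArg y j.succ + k * (2 * Real.pi) := by
        have h5 := congrArg Complex.im hk
        simpa using h5
      have hk0 : k = 0 := by
        have hp := Real.pi_pos
        have h6 : (k : ℝ) < 1 := by nlinarith
        have h7 : (-1 : ℝ) < k := by nlinarith
        have h8 : k < 1 := by exact_mod_cast h6
        have h9 : -1 < k := by exact_mod_cast h7
        omega
      have hfin : sliceArg z j.succ = sliceArg y j.succ := by simpa [hk0] using hk'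
      exact hfin

/-! ### Angle forms and weights -/

/-- `exp(i φ)` for the hyperbolic angle `φ = φ(p, q; ξ)` at `p`, counted counterclockwise, from the
geodesic joining `p` to `ξ` to the geodesic joining `p` to `q`, up to a positive factor: after `p` is
moved to the origin, geodesics through `p` are straight. -/
def angleRatio (p q ξ : ℂ) : ℂ := diskMobius 1 p q / diskMobius 1 p ξ

/-- The differential at `y` of the argument of a function `F` with `F y ≠ 0`, which is
well-defined although the argument is defined modulo `2π` only: `d arg F = Im (dF / F)`. -/
def dArg {Y : Type*} [NormedAddCommGroup Y] [NormedSpace ℝ Y] (F : Y → ℂ) (y : Y) : Y →L[ℝ] ℝ :=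
  Complex.imCLM.comp ((F y)⁻¹ • fderiv ℝ F y)

/-- The position of a vertex of the graph in the configuration with coordinates `y`. -/
def vertexPos {n m : ℕ} (y : SliceCoord n m) : Fin (n + 1) ⊕ Fin (m + 1) → ℂ :=
  Sum.elim (sliceInt y) (sliceBdry y)

/-- The 1-form `dφ_{e; α} = ∑_j α_j dφ(p, q; q_j)` of an edge `e` from `p` to `q`. -/
def edgeForm {n m : ℕ} (Γ : AdmissibleGraph (n + 1) (m + 1)) (α : Fin (m + 1) → ℝ) (e : Γ.Edge)
    (y : SliceCoord n m) : SliceCoord n m →L[ℝ] ℝ :=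
  ∑ j, α j • dArg (fun z => angleRatio (sliceInt z e.1) (vertexPos z (Γ.target e.1 e.2))
    (sliceBdry z j)) y

/-- The coordinate vectors `∂/∂Re w_1, ∂/∂Im w_1, …, ∂/∂Re w_n, ∂/∂Im w_n, ∂/∂t_1, …, ∂/∂t_m`,
in this order. -/
def sliceFrame {n m : ℕ} (a : Fin (n * 2 + m)) : SliceCoord n m :=
  match finSumFinEquiv.symm a with
  | Sum.inl b =>
    (Pi.single (finProdFinEquiv.symm b).1
      (if (finProdFinEquiv.symm b).2 = 0 then 1 else Complex.I), 0)
  | Sum.inr j => (0, Pi.single j 1)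

theorem sum_star_eq {n m : ℕ} (Γ : AdmissibleGraph (n + 1) (m + 1)) :
    n * 2 + m = ∑ k, Γ.star k := by
  have := Γ.card_edges
  omega

/-- The coefficient of the top form `⋀_e dφ_{e; α}` with respect to the coordinate volume form; the
edges are in lexicographic order, and `(η_1 ∧ ⋯ ∧ η_N)(b_1, …, b_N) = det (η_i(b_j))`. -/
def weightDensity {n m : ℕ} (Γ : AdmissibleGraph (n + 1) (m + 1)) (α : Fin (m + 1) → ℝ)
    (y : SliceCoord n m) : ℝ :=
  (Matrix.of fun a b : Fin (n * 2 + m) =>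
    edgeForm Γ α (finSigmaFinEquiv.symm (finCongr (sum_star_eq Γ) a)) y (sliceFrame b)).det

/-- The weight of a graph with `N = n + 1` vertices of the first type and `M = m + 1` vertices of
the second type: `∏_k 1 / (#Star(k))!` times `(2π)^{-(2N + M - 2)}` times the integral of
`⋀_e dφ_{e; α}`. -/
def weight {n m : ℕ} (Γ : AdmissibleGraph (n + 1) (m + 1)) (α : Fin (m + 1) → ℝ) : ℝ :=
  (∏ k, ((Γ.star k).factorial : ℝ)⁻¹) * ((2 * Real.pi) ^ (2 * (n + 1) + (m + 1) - 2))⁻¹ *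
    ∫ y in sliceDomain n m, weightDensity Γ α y

/-- `Ũ^α(γ_1 ∧ ⋯ ∧ γ_N)(f_1 ⊗ ⋯ ⊗ f_M)` with `N = n + 1`, `M = m + 1`: the sum over all graphs in
`G_{N,M}` of the weights times the skew-symmetrized operators. -/
def kontsevichOperator {d n m : ℕ} {𝕜 : Type*} [RCLike 𝕜] (α : Fin (m + 1) → ℝ)
    (γ : Fin (n + 1) → Polyvector d 𝕜) (f : Fin (m + 1) → (Fin d → ℝ) → 𝕜)
    (x : Fin d → ℝ) : 𝕜 :=
  ∑ Γ : AdmissibleGraph (n + 1) (m + 1), (weight Γ α : 𝕜) * skewGraphOperator Γ γ f x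

end CyclicFormality

end

/-!
The integral in question is, up to a constant, the integral over the configuration space of
`∑_Γ c_Γ det (dφ_{e;α})_e`, with `c_Γ` the integral of the skew-symmetrized operator of `Γ`. The
integrand is already independent of `α`, at each configuration, as long as `∑ αⱼ` is fixed.

*Dependence on `α`.* Let `M_k` be the automorphism of the disk that moves `p_k` to the origin. As
`φ(p_k, q; ξ) = arg M_k(q) - arg M_k(ξ)`, the form of an edge from `k` to `v` is
`(∑ αⱼ) d arg M_k(p_v) - ∑ αⱼ d arg M_k(qⱼ)` (`vertexForm_eq`). A change of `α` with fixed sum therefore adds to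
it a form that does not depend on the end `v` of the edge. Fix the numbers of edges that start at
each vertex and expand the determinant in these corrections. In a term that contains the
correction of an edge `e₀`, the only dependence on the end of `e₀` is in the operator, and the sum
of the integrals of the operators over all possible ends vanishes, so the term drops out
(`sum_multilinear_add_eq`). Indeed, by the Leibniz rule this sum is the factor of the start of
`e₀` times a derivative of the product of all other factors, and an integration by parts turns it
into a divergence
(`sum_integral_targetOperator_update`, with the coordinate expression of the divergence from
`Polyvector.IsDivFree.sum_fderiv_update`). The ends that would produce a multiple edge may be
included, since their operators vanish by skew-symmetry (`targetOperator_eq_zero_of_multiple`).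

*Absolute convergence.* The Cayley transform moves `p_1` to `i` and `q_1` to infinity. In the
half-plane model every edge form is a linear combination of forms `d arg F`, with `F` one of
`Z_v - Z_k`, `Z_v - \bar Z_k`, `Z_k + i`, `\bar Z_k - i`, where `Z_v` is the position of `v`. All of
them are real-affine functions of the coordinates (`vertexForm_mem`). So it is enough to integrate
a determinant of such forms. Fixing the arguments of the functions `F` is a system of affine
equations in the coordinates. Where the determinant does not vanish, this system has a unique
solution, so the map to the arguments is injective there, and by the area formula the integral of
the absolute value of the determinant is the volume of a bounded set
(`integrableOn_det_dArg_affine`). No compactification of the configuration space is needed.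
-/

noncomputable section

namespace CyclicFormality

/-! ### Divergence-free polyvector fields in coordinates -/

section Juxtaposition

variable {X E F : Type*} [NormedAddCommGroup E] [NormedSpace ℝ E]
    [NormedAddCommGroup F] [NormedSpace ℝ F] {d k l : ℕ}

/-- The juxtaposition `(v_0, …, v_{k-1}, u_0, …, u_{l-1})`, as a family indexed by `Fin d`. -/
def juxtapose (h : d = l + k) (v : Fin k → X) (u : Fin l → X) (i : Fin d) : X :=
  if hi : i.1 < k then v ⟨i, hi⟩ else u ⟨i - k, by omega⟩

theorem juxtapose_comp {Y : Type*} (h : d = l + k) (g : X → Y) (v : Fin k → X) (u : Fin l → X) :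
    juxtapose h (fun a => g (v a)) (fun a => g (u a)) = fun i => g (juxtapose h v u i) := by
  funext i
  simp only [juxtapose]
  split_ifs <;> rfl

theorem insertVectors_apply (v : Fin k → E) (η : E [⋀^Fin (l + k)]→L[ℝ] F) (u : Fin l → E) :
    insertVectors k v η u = η (juxtapose rfl v u) := by
  induction k with
  | zero =>
    have : juxtapose rfl v u = u := by
      funext i
      simp [juxtapose]
    rw [this]
    rfl
  | succ k ih =>
    rw [insertVectors, ih]
    refine (congrArg η ?_ : η (Matrix.vecCons (v 0) (juxtapose rfl (Fin.tail v) u)) = _)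
    funext i
    refine Fin.cases ?_ (fun i => ?_) i
    · simp [juxtapose]
    · simp only [Matrix.cons_val_succ, juxtapose, Fin.val_succ, Nat.add_lt_add_iff_right,
        Fin.tail, Nat.add_sub_add_right]
      rfl

theorem insertVectors_castForm_apply (h : d = l + k) (v : Fin k → E) (η : E [⋀^Fin d]→L[ℝ] F)
    (u : Fin l → E) : insertVectors k v (castForm h η) u = η (juxtapose h v u) := by
  subst h
  exact insertVectors_apply v η u

theorem juxtapose_snoc (h : d = l + (k + 1)) (v : Fin k → X) (x : X) (u : Fin l → X) :
    juxtapose h (Fin.snoc (α := fun _ => X) v x) u =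
      juxtapose (show d = l + 1 + k by omega) v (Fin.cons (α := fun _ => X) x u) := by
  funext i
  simp only [juxtapose, Fin.snoc]
  rcases lt_trichotomy i.1 k with hi | hi | hi
  · have h1 : i.1 < k + 1 := by omega
    simp [hi, h1]
  · have h1 : i.1 < k + 1 := by omega
    have h2 : (⟨i.1 - k, by omega⟩ : Fin (l + 1)) = 0 := by
      ext
      simp [hi]
    simp [hi]
  · have h1 : ¬ i.1 < k + 1 := by omega
    have h2 : ¬ i.1 < k := by omega
    have h3 : (⟨i.1 - k, by omega⟩ : Fin (l + 1)) = Fin.succ ⟨i.1 - (k + 1), by omega⟩ := by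
      ext
      simp
      omega
    rw [dif_neg h1, dif_neg h2, h3, Fin.cons_succ]

theorem juxtapose_castLE (h : d = l + k) (v : Fin k → X) (u : Fin l → X) (a : Fin k) :
    juxtapose h v u (Fin.castLE (by omega) a) = v a := by
  simp [juxtapose]

theorem juxtapose_comp_swap (h : d = l + k) (v : Fin k → X) (u : Fin l → X) (a b : Fin k) :
    juxtapose h (v ∘ Equiv.swap a b) u = juxtapose h v u ∘
      Equiv.swap (Fin.castLE (show k ≤ d by omega) a) (Fin.castLE (show k ≤ d by omega) b) := by
  have hk : k ≤ d := by omega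
  funext i
  by_cases hi : i.1 < k
  · obtain ⟨c, rfl⟩ : ∃ c : Fin k, i = Fin.castLE hk c := ⟨⟨i, hi⟩, rfl⟩
    rw [Function.comp_apply, (Fin.castLE_injective hk).swap_apply, juxtapose_castLE,
      juxtapose_castLE, Function.comp_apply]
  · have h1 : ∀ c : Fin k, i ≠ Fin.castLE hk c := fun c hc => hi (by rw [hc]; exact c.2)
    rw [Function.comp_apply, Equiv.swap_apply_of_ne_of_ne (h1 a) (h1 b)]
    simp [juxtapose, hi]

theorem juxtapose_injective (h : d = l + k) {v : Fin k → X} {u : Fin l → X}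
    (hv : Function.Injective v) (hu : Function.Injective u) (hvu : ∀ a b, v a ≠ u b) :
    Function.Injective (juxtapose h v u) := by
  intro i j hij
  simp only [juxtapose] at hij
  split_ifs at hij with hi hj hj
  · exact Fin.ext (Fin.mk.inj_iff.1 (hv hij))
  · exact absurd hij (hvu _ _)
  · exact absurd hij.symm (hvu _ _)
  · have := Fin.ext_iff.1 (hu hij)
    simp only at this
    exact Fin.ext (by omega)

/-- A form of top degree does not vanish on a permutation of a coordinate basis. -/
theorem apply_coordVector_ne_zero {Ω : (Fin d → ℝ) [⋀^Fin d]→L[ℝ] ℝ} (hΩ : Ω ≠ 0)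
    {w : Fin d → Fin d} (hw : Function.Injective w) : Ω (fun i => coordVector (w i)) ≠ 0 := by
  have h0 : Ω (fun i => coordVector i) ≠ 0 := by
    intro h
    apply hΩ
    have h1 : Ω.toAlternatingMap = 0 := by
      refine (Ω.toAlternatingMap.map_basis_eq_zero_iff (Pi.basisFun ℝ (Fin d))).1 ?_
      have : ⇑(Pi.basisFun ℝ (Fin d)) = fun i => coordVector i := by
        funext i
        simp [coordVector]
      rw [this]
      exact h
    ext v
    exact congrFun (congrArg DFunLike.coe h1) v
  have hb : Function.Bijective w := Finite.injective_iff_bijective.1 hw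
  have h2 := Ω.toAlternatingMap.map_perm (fun i => coordVector i) (Equiv.ofBijective w hb)
  have h3 : Ω (fun i => coordVector (w i)) =
    (Equiv.Perm.sign (Equiv.ofBijective w hb)) • Ω (fun i => coordVector i) := h2
  rw [h3]
  rcases Int.units_eq_one_or (Equiv.Perm.sign (Equiv.ofBijective w hb)) with h | h <;>
    simpa [h] using h0

end Juxtaposition

/-- The sum of a function on multi-indices that is invariant under permutations and supported on the
rearrangements of one injective multi-index: each of them contributes the same term. -/
theorem sum_multiIndex_eq {ι κ R : Type*} [Fintype ι] [DecidableEq ι] [Fintype κ] [DecidableEq κ]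
    [Semiring R] (g : (κ → ι) → R) (I₀ : κ → ι) (hI₀ : Function.Injective I₀)
    (hswap : ∀ I a b, g (I ∘ Equiv.swap a b) = g I)
    (hsupp : ∀ I, g I ≠ 0 → Function.Injective I ∧ ∀ b, I b ∈ Set.range I₀) :
    ∑ I, g I = ((Fintype.card κ).factorial : R) * g I₀ := by
  have hperm : ∀ π : Equiv.Perm κ, ∀ I, g (I ∘ π) = g I := by
    intro π
    induction π using Equiv.Perm.swap_induction_on with
    | one => intro I; rfl
    | swap_mul f x y hxy ih =>
      intro I
      have : I ∘ (Equiv.swap x y * f) = (I ∘ Equiv.swap x y) ∘ f := rfl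
      rw [this, ih, hswap]
  have hinj : Set.InjOn (fun π : Equiv.Perm κ => I₀ ∘ π)
      ((Finset.univ : Finset (Equiv.Perm κ)) : Set (Equiv.Perm κ)) := by
    intro π _ π' _ h
    ext b
    exact hI₀ (congrFun h b)
  have hsum := Finset.sum_image (f := g) hinj
  rw [Finset.sum_congr rfl (fun π _ => hperm π I₀), Finset.sum_const, Finset.card_univ,
    Fintype.card_perm, nsmul_eq_mul] at hsum
  rw [← hsum]
  symm
  refine Finset.sum_subset (Finset.subset_univ _) fun I _ hI => ?_
  by_contra hne
  obtain ⟨h1, h2⟩ := hsupp I hne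
  choose π hπ using h2
  have hπinj : Function.Injective π := by
    intro b c h
    apply h1
    rw [← hπ b, ← hπ c, h]
  refine hI (Finset.mem_image.2
    ⟨Equiv.ofBijective π (Finite.injective_iff_bijective.1 hπinj), Finset.mem_univ _, ?_⟩)
  funext b
  exact hπ b

section Divergence

variable {d : ℕ} {𝕜 : Type*} [RCLike 𝕜]

theorem contract_apply {k l : ℕ} (P : ((Fin d → ℝ) →L[ℝ] ℝ) [⋀^Fin k]→L[ℝ] 𝕜)
    (Ω : (Fin d → ℝ) [⋀^Fin d]→L[ℝ] ℝ) (h : d = l + k) (u : Fin l → Fin d → ℝ) :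
    contract P (castForm h Ω) u = ((k.factorial : ℝ)⁻¹) • ∑ I : Fin k → Fin d,
      P (fun a => coordCovector (I a)) *
        ((Ω (juxtapose h (fun a => coordVector (I a)) u) : ℝ) : 𝕜) := by
  simp only [contract, ContinuousAlternatingMap.smul_apply, ContinuousAlternatingMap.sum_apply,
    smul_eq_mul, ContinuousLinearMap.compContinuousAlternatingMap_coe, Function.comp_apply,
    insertVectors_castForm_apply, RCLike.ofRealCLM_apply]

theorem hasFDerivAt_apply_const {k : ℕ}
    {P : (Fin d → ℝ) → ((Fin d → ℝ) →L[ℝ] ℝ) [⋀^Fin k]→L[ℝ] 𝕜} {x : Fin d → ℝ}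
    (hP : DifferentiableAt ℝ P x) (v : Fin k → (Fin d → ℝ) →L[ℝ] ℝ) :
    HasFDerivAt (fun y => P y v) ((fderiv ℝ P x).flipAlternating v) x :=
  hP.hasFDerivAt.continuousAlternatingMap_apply_const v

theorem differentiableAt_contract {k l : ℕ}
    {P : (Fin d → ℝ) → ((Fin d → ℝ) →L[ℝ] ℝ) [⋀^Fin k]→L[ℝ] 𝕜} {x : Fin d → ℝ}
    (hP : DifferentiableAt ℝ P x) (Ω : (Fin d → ℝ) [⋀^Fin (l + k)]→L[ℝ] ℝ) :
    DifferentiableAt ℝ (fun y => contract (P y) Ω) x := by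
  have h : DifferentiableAt ℝ (fun y => ∑ I : Fin k → Fin d,
      P y (fun a => coordCovector (I a)) •
        (RCLike.ofRealCLM (K := 𝕜)).compContinuousAlternatingMap
          (insertVectors k (fun a => coordVector (I a)) Ω)) x :=
    DifferentiableAt.fun_sum fun I _ => (hasFDerivAt_apply_const hP
      (fun a => coordCovector (I a))).differentiableAt.smul_const _
  exact h.const_smul ((k.factorial : ℝ)⁻¹)

theorem fderiv_contract_apply {k l : ℕ}
    {P : (Fin d → ℝ) → ((Fin d → ℝ) →L[ℝ] ℝ) [⋀^Fin k]→L[ℝ] 𝕜} {x : Fin d → ℝ}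
    (hP : DifferentiableAt ℝ P x) (Ω : (Fin d → ℝ) [⋀^Fin d]→L[ℝ] ℝ) (h : d = l + k)
    (u : Fin l → Fin d → ℝ) (v : Fin d → ℝ) :
    fderiv ℝ (fun y => contract (P y) (castForm h Ω) u) x v =
      contract (fderiv ℝ P x v) (castForm h Ω) u := by
  simp only [contract_apply]
  have h1 := (HasFDerivAt.fun_sum fun (I : Fin k → Fin d) (_ : I ∈ Finset.univ) =>
    (hasFDerivAt_apply_const hP (fun a => coordCovector (I a))).mul_const
      ((Ω (juxtapose h (fun a => coordVector (I a)) u) : ℝ) : 𝕜)).const_smul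
        ((k.factorial : ℝ)⁻¹)
  refine (congrArg (fun L => L v) h1.fderiv).trans ?_
  simp [mul_comm]

theorem apply_coordCovector_eq_zero {k : ℕ} (Q : ((Fin d → ℝ) →L[ℝ] ℝ) [⋀^Fin k]→L[ℝ] 𝕜)
    {I : Fin k → Fin d} (hI : ¬ Function.Injective I) :
    Q (fun a => coordCovector (I a)) = 0 := by
  refine Q.map_eq_zero_of_not_injective _ fun h => hI fun a b hab => h ?_
  simp only [hab]

/-- In the contraction of a form of top degree, evaluated on coordinate vectors, only the
coordinates of `P` with the complementary indices `I₀` survive, and its `k!` rearrangements give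
equal terms. -/
theorem contract_apply_coordVector {k l : ℕ} (P : ((Fin d → ℝ) →L[ℝ] ℝ) [⋀^Fin k]→L[ℝ] 𝕜)
    (Ω : (Fin d → ℝ) [⋀^Fin d]→L[ℝ] ℝ) (h : d = l + k) (I₀ : Fin k → Fin d)
    (K : Fin l → Fin d) (hIK : Function.Injective (juxtapose h I₀ K)) :
    contract P (castForm h Ω) (fun b => coordVector (K b)) =
      P (fun a => coordCovector (I₀ a)) *
        ((Ω (fun i => coordVector (juxtapose h I₀ K i)) : ℝ) : 𝕜) := by
  have hkd : k ≤ d := by omega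
  have hI₀ : Function.Injective I₀ := by
    intro a b hab
    refine Fin.castLE_injective hkd (hIK ?_)
    rw [juxtapose_castLE, juxtapose_castLE, hab]
  have hsurj : Function.Surjective (juxtapose h I₀ K) := Finite.injective_iff_surjective.1 hIK
  rw [contract_apply, sum_multiIndex_eq _ I₀ hI₀, Fintype.card_fin, juxtapose_comp]
  · rw [RCLike.real_smul_eq_coe_mul, ← mul_assoc]
    have : ((k.factorial : ℕ) : 𝕜) ≠ 0 := by exact_mod_cast k.factorial_ne_zero
    push_cast
    rw [inv_mul_cancel₀ this, one_mul]
  · intro I a b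
    by_cases hab : a = b
    · subst hab
      simp
    have e1 : P (fun c => coordCovector ((I ∘ Equiv.swap a b) c)) =
        - P (fun c => coordCovector (I c)) :=
      P.toAlternatingMap.map_swap (fun c => coordCovector (I c)) hab
    have e2 : Ω (juxtapose h (fun c => coordVector ((I ∘ Equiv.swap a b) c))
        (fun b => coordVector (K b))) = - Ω (juxtapose h (fun c => coordVector (I c))
        (fun b => coordVector (K b))) := by
      have := juxtapose_comp_swap h (fun c => coordVector (I c)) (fun b => coordVector (K b)) a b
      refine (congrArg Ω this).trans ?_
      exact Ω.toAlternatingMap.map_swap _ (fun h => hab (Fin.castLE_injective hkd h))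
    rw [e1, e2]
    push_cast
    ring
  · intro I hI
    refine ⟨?_, fun b => ?_⟩
    · by_contra hn
      exact hI (by rw [apply_coordCovector_eq_zero P hn, zero_mul])
    · by_contra hn
      obtain ⟨i, hi⟩ := hsurj (I b)
      have hik : ¬ i.1 < k := by
        intro hik
        refine hn ⟨⟨i, hik⟩, ?_⟩
        rw [← hi]
        simp [juxtapose, hik]
      apply hI
      have hne : Fin.castLE hkd b ≠ i := by
        rintro rfl
        exact hik b.2
      have : Ω (juxtapose h (fun a => coordVector (I a)) (fun b => coordVector (K b))) = 0 := by
        refine Ω.map_eq_zero_of_eq _ ?_ hne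
        rw [juxtapose_castLE, ← hi]
        simp [juxtapose, hik]
      rw [this]
      simp

/-- The coordinate form of the vanishing of the divergence, for the last index. -/
theorem Polyvector.IsDivFree.sum_fderiv_snoc {γ : Polyvector d 𝕜}
    {Ω : (Fin d → ℝ) [⋀^Fin d]→L[ℝ] ℝ} (hΩ : Ω ≠ 0) (hγ : γ.IsDivFree Ω) {k : ℕ}
    (J : Fin k → Fin d) (x : Fin d → ℝ) :
    ∑ i, fderiv ℝ (γ.comp (k + 1)) x (coordVector i)
      (fun a => coordCovector (Fin.snoc (α := fun _ => Fin d) J i a)) = 0 := by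
  have hdiff : DifferentiableAt ℝ (γ.comp (k + 1)) x :=
    (γ.smooth (k + 1)).differentiable (by simp) x
  by_cases hJ : Function.Injective J
  swap
  · refine Finset.sum_eq_zero fun i _ => apply_coordCovector_eq_zero _ fun h => hJ ?_
    intro a b hab
    refine Fin.castSucc_injective k (h ?_)
    simp [hab]
  by_cases hkd : k + 1 ≤ d
  swap
  · refine Finset.sum_eq_zero fun i _ => apply_coordCovector_eq_zero _ fun h => hkd ?_
    simpa using Fintype.card_le_of_injective _ h
  obtain ⟨l, h⟩ : ∃ l, d = l + (k + 1) := ⟨d - (k + 1), by omega⟩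
  have h' : d = l + 1 + k := by omega
  -- an enumeration of the indices that do not occur in `J`
  obtain ⟨K, hKinj, hKrange⟩ : ∃ K : Fin (l + 1) → Fin d, Function.Injective K ∧
      ∀ i, i ∈ Set.range K ↔ i ∉ Set.range J := by
    let S : Finset (Fin d) := (Finset.univ.image J)ᶜ
    have hS : S.card = l + 1 := by
      rw [Finset.card_compl, Finset.card_image_of_injective _ hJ]
      simp
      omega
    refine ⟨S.orderEmbOfFin hS, (S.orderEmbOfFin hS).injective, fun i => ?_⟩
    rw [Finset.range_orderEmbOfFin]
    simp [S]
  have hJK : ∀ a b, J a ≠ K b := fun a b hab => (hKrange (K b)).1 ⟨b, rfl⟩ ⟨a, hab⟩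
  have hjux : ∀ a : Fin (l + 1), Function.Injective (juxtapose h
      (Fin.snoc (α := fun _ => Fin d) J (K a)) (a.removeNth K)) := by
    intro a
    rw [juxtapose_snoc]
    refine juxtapose_injective _ hJ (Fin.cons_injective_iff.2 ⟨?_, ?_⟩) ?_
    · rintro ⟨b, hb⟩
      exact Fin.succAbove_ne a b (hKinj hb)
    · exact hKinj.comp Fin.succAbove_right_injective
    · intro b c
      refine Fin.cases ?_ (fun c => ?_) c
      · exact hJK b a
      · exact hJK b _
  have hjuxJK : Function.Injective (juxtapose h' J K) := juxtapose_injective _ hJ hKinj hJK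
  have hc := apply_coordVector_ne_zero hΩ hjuxJK
  have key := congrArg (fun η => η (fun b => coordVector (K b))) (hγ (k + 1) l h x)
  simp only [extDeriv_apply (differentiableAt_contract hdiff _)] at key
  have hterm : ∀ a : Fin (l + 1), (-1) ^ a.1 • fderiv ℝ (fun y => contract (γ.comp (k + 1) y)
      (castForm h Ω) (a.removeNth fun b => coordVector (K b))) x (coordVector (K a)) =
      fderiv ℝ (γ.comp (k + 1)) x (coordVector (K a))
      (fun c => coordCovector (Fin.snoc (α := fun _ => Fin d) J (K a) c)) *
      ((Ω (fun i => coordVector (juxtapose h' J K i)) : ℝ) : 𝕜) := by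
    intro a
    have e1 : (a.removeNth fun b => (coordVector (K b) : Fin d → ℝ)) =
      fun b => coordVector (a.removeNth K b) := rfl
    rw [e1, fderiv_contract_apply hdiff, contract_apply_coordVector _ _ _ _ _ (hjux a),
      juxtapose_snoc]
    -- moving `K a` to its place among the complementary indices costs the sign `(-1) ^ a`
    have e2 := (insertVectors k (fun b => coordVector (J b))
      (castForm h' Ω)).neg_one_pow_smul_map_insertNth a (coordVector (K a))
        (fun b => coordVector (a.removeNth K b))
    have e3 : a.insertNth (α := fun _ => Fin d → ℝ) (coordVector (K a))
        (fun b => coordVector (a.removeNth K b)) = fun b => coordVector (K b) :=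
      Fin.insertNth_self_removeNth a (fun b => (coordVector (K b) : Fin d → ℝ))
    have e4 : Matrix.vecCons (coordVector (K a)) (fun b => coordVector (a.removeNth K b)) =
        fun b => (coordVector (Fin.cons (α := fun _ => Fin d) (K a) (a.removeNth K) b) :
          Fin d → ℝ) := by
      funext b
      refine Fin.cases ?_ (fun b => ?_) b <;> rfl
    rw [e3, e4, insertVectors_castForm_apply, insertVectors_castForm_apply, juxtapose_comp,
      juxtapose_comp] at e2
    rw [← e2, mul_comm, ← smul_mul_assoc, mul_comm]
    congr 1
    rcases neg_one_pow_eq_or ℤ a.1 with hs | hs <;> simp [hs]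
  have key2 : (∑ a, fderiv ℝ (γ.comp (k + 1)) x (coordVector (K a))
      (fun c => coordCovector (Fin.snoc (α := fun _ => Fin d) J (K a) c))) *
      ((Ω (fun i => coordVector (juxtapose h' J K i)) : ℝ) : 𝕜) = 0 := by
    rw [Finset.sum_mul, ← Finset.sum_congr rfl fun a _ => hterm a]
    exact key
  have key3 := (mul_eq_zero.1 key2).resolve_right (by exact_mod_cast hc)
  rw [← key3, ← Finset.sum_image (s := Finset.univ) (g := K) (f := fun i =>
    fderiv ℝ (γ.comp (k + 1)) x (coordVector i)
      (fun c => coordCovector (Fin.snoc (α := fun _ => Fin d) J i c))) hKinj.injOn]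
  symm
  refine Finset.sum_subset (Finset.subset_univ _) fun i _ hi => ?_
  refine apply_coordCovector_eq_zero _ fun hinj => ?_
  have hiJ : i ∈ Set.range J := by
    by_contra hn
    obtain ⟨b, hb⟩ := (hKrange i).2 hn
    exact hi (Finset.mem_image.2 ⟨b, Finset.mem_univ _, hb⟩)
  obtain ⟨b, hb⟩ := hiJ
  have : b.castSucc = Fin.last k := hinj (by simp [hb])
  exact b.castSucc_lt_last.ne this

/-- The coordinate form of the vanishing of the divergence: `∑ᵢ ∂ᵢ γ^{… i …} = 0`, with the index
`i` in an arbitrary place. -/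
theorem Polyvector.IsDivFree.sum_fderiv_update {γ : Polyvector d 𝕜}
    {Ω : (Fin d → ℝ) [⋀^Fin d]→L[ℝ] ℝ} (hΩ : Ω ≠ 0) (hγ : γ.IsDivFree Ω) {k : ℕ}
    (J : Fin k → Fin d) (a : Fin k) (x : Fin d → ℝ) :
    ∑ i, fderiv ℝ (fun y => γ.comp k y (fun c => coordCovector (Function.update J a i c))) x
      (coordVector i) = 0 := by
  have hdiff : DifferentiableAt ℝ (γ.comp k) x := (γ.smooth k).differentiable (by simp) x
  have h0 : ∀ i, fderiv ℝ (fun y => γ.comp k y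
      (fun c => coordCovector (Function.update J a i c))) x (coordVector i) =
      fderiv ℝ (γ.comp k) x (coordVector i)
        (fun c => coordCovector (Function.update J a i c)) := by
    intro i
    rw [(hasFDerivAt_apply_const hdiff _).fderiv]
    rfl
  rw [Finset.sum_congr rfl fun i _ => h0 i]
  cases k with
  | zero => exact a.elim0
  | succ k =>
    let σ := Equiv.swap a (Fin.last k)
    have h1 := hγ.sum_fderiv_snoc hΩ (Fin.init (α := fun _ => Fin d) (J ∘ σ)) x
    have h2 : ∀ i, (fun c => (coordCovector (Function.update J a i c) : (Fin d → ℝ) →L[ℝ] ℝ)) =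
        (fun c => coordCovector (Fin.snoc (α := fun _ => Fin d)
          (Fin.init (α := fun _ => Fin d) (J ∘ σ)) i c)) ∘ σ := by
      intro i
      funext c
      have h3 : Fin.snoc (α := fun _ => Fin d) (Fin.init (α := fun _ => Fin d) (J ∘ σ)) i =
          Function.update (J ∘ σ) (Fin.last k) i := by
        conv_rhs => rw [← Fin.snoc_init_self (α := fun _ => Fin d) (J ∘ σ)]
        rw [Fin.update_snoc_last]
      simp only [Function.comp_apply, h3]
      congr 1
      by_cases hc : c = a
      · subst hc
        simp [σ]
      · have : σ c ≠ Fin.last k := by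
          intro h
          apply hc
          have := congrArg σ h
          simpa [σ] using this
        rw [Function.update_of_ne hc, Function.update_of_ne this]
        simp [σ]
    have h4 : ∀ i, fderiv ℝ (γ.comp (k + 1)) x (coordVector i)
        (fun c => coordCovector (Function.update J a i c)) = Equiv.Perm.sign σ •
        fderiv ℝ (γ.comp (k + 1)) x (coordVector i) (fun c => coordCovector
          (Fin.snoc (α := fun _ => Fin d) (Fin.init (α := fun _ => Fin d) (J ∘ σ)) i c)) := by
      intro i
      rw [h2 i]
      exact (fderiv ℝ (γ.comp (k + 1)) x (coordVector i)).toAlternatingMap.map_perm _ σ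
    rw [Finset.sum_congr rfl fun i _ => h4 i, ← Finset.smul_sum, h1, smul_zero]

end Divergence

/-! ### Iterated partial derivatives -/

section IterPartial

variable {d : ℕ} {𝕜 : Type*} [RCLike 𝕜] {g : (Fin d → ℝ) → 𝕜}

theorem contDiff_fderiv_coordVector (hg : ContDiff ℝ ∞ g) (v : Fin d → ℝ) :
    ContDiff ℝ ∞ (fun x => fderiv ℝ g x v) :=
  (hg.fderiv_right (by simp)).clm_apply contDiff_const

theorem contDiff_iterPartial (hg : ContDiff ℝ ∞ g) (L : List (Fin d)) :
    ContDiff ℝ ∞ (iterPartial L g) := by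
  induction L with
  | nil => exact hg
  | cons i L ih => exact contDiff_fderiv_coordVector ih _

theorem tsupport_iterPartial_subset (g : (Fin d → ℝ) → 𝕜) (L : List (Fin d)) :
    tsupport (iterPartial L g) ⊆ tsupport g := by
  induction L with
  | nil => exact subset_rfl
  | cons i L ih => exact (tsupport_fderiv_apply_subset ℝ _).trans ih

theorem hasCompactSupport_iterPartial (hg : HasCompactSupport g) (L : List (Fin d)) :
    HasCompactSupport (iterPartial L g) :=
  hg.of_isClosed_subset (isClosed_tsupport _) (tsupport_iterPartial_subset g L)

theorem iterPartial_perm (hg : ContDiff ℝ ∞ g) {L L' : List (Fin d)} (h : L.Perm L') :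
    iterPartial L g = iterPartial L' g := by
  induction h with
  | nil => rfl
  | cons i _ ih =>
    change (fun x => fderiv ℝ (iterPartial _ g) x _) = fun x => fderiv ℝ (iterPartial _ g) x _
    rw [ih]
  | swap i j L =>
    have hL := contDiff_iterPartial hg L
    funext x
    have hd : DifferentiableAt ℝ (fderiv ℝ (iterPartial L g)) x :=
      ((hL.fderiv_right (m := ∞) (by simp)).differentiable (by simp)) x
    have hs : IsSymmSndFDerivAt ℝ (iterPartial L g) x :=
      hL.contDiffAt.isSymmSndFDerivAt (by
      rw [minSmoothness_of_isRCLikeNormedField]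
      exact WithTop.coe_le_coe.2 le_top)
    change fderiv ℝ (fun y => fderiv ℝ (iterPartial L g) y (coordVector i)) x (coordVector j) =
      fderiv ℝ (fun y => fderiv ℝ (iterPartial L g) y (coordVector j)) x (coordVector i)
    rw [fderiv_clm_apply hd (differentiableAt_const _),
      fderiv_clm_apply hd (differentiableAt_const _)]
    simpa using hs _ _
  | trans _ _ ih1 ih2 => exact ih1.trans ih2

theorem iterPartial_sum {ι : Type*} (s : Finset ι) {g : ι → (Fin d → ℝ) → 𝕜}
    (hg : ∀ i ∈ s, ContDiff ℝ ∞ (g i)) (L : List (Fin d)) :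
    iterPartial L (fun x => ∑ i ∈ s, g i x) = fun x => ∑ i ∈ s, iterPartial L (g i) x := by
  induction L with
  | nil => rfl
  | cons j L ih =>
    funext x
    change fderiv ℝ (iterPartial L _) x _ = ∑ i ∈ s, fderiv ℝ (iterPartial L (g i)) x _
    rw [ih, fderiv_fun_sum fun i hi =>
      ((contDiff_iterPartial (hg i hi) L).differentiable (by simp)) x]
    simp

theorem iterPartial_zero (L : List (Fin d)) :
    iterPartial L (fun _ => (0 : 𝕜)) = fun _ => 0 := by
  simpa using iterPartial_sum (𝕜 := 𝕜) (g := fun (_ : Empty) _ => 0) ∅ (by simp) L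

theorem iterPartial_neg (g : (Fin d → ℝ) → 𝕜) (L : List (Fin d)) :
    iterPartial L (fun x => - g x) = fun x => - iterPartial L g x := by
  induction L with
  | nil => rfl
  | cons j L ih =>
    funext x
    change fderiv ℝ (iterPartial L _) x _ = - fderiv ℝ (iterPartial L g) x _
    rw [ih, fderiv_fun_neg]
    simp

end IterPartial

/-! ### The polydifferential operator of a family of targets -/

/-- If all the partial sums of `g` in the direction of one coordinate vanish, so does the
total sum. -/
theorem sum_pi_eq_zero_of_sum_update {ι R : Type*} [Fintype ι] [DecidableEq ι] {W : ι → Type*}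
    [∀ i, Fintype (W i)] [AddCommMonoid R] (e : ι) (g : (∀ i, W i) → R)
    (h : ∀ τ, ∑ v, g (Function.update τ e v) = 0) : ∑ τ, g τ = 0 := by
  rw [← (Equiv.piSplitAt e W).symm.sum_comp g, Fintype.sum_prod_type_right]
  refine Finset.sum_eq_zero fun r _ => ?_
  by_cases hW : IsEmpty (W e)
  · simp
  · obtain ⟨w⟩ := not_isEmpty_iff.1 hW
    rw [← h ((Equiv.piSplitAt e W).symm (w, r))]
    refine Finset.sum_congr rfl fun v _ => congrArg g ?_
    funext i
    by_cases hi : i = e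
    · subst hi
      simp [Equiv.piSplitAt]
    · simp [Equiv.piSplitAt, hi]

section TargetOperator

variable {d n m : ℕ} {𝕜 : Type*} [RCLike 𝕜]

/-- The edges `(k, a)`, `a < s k`, in lexicographic order. -/
def starEdges (s : Fin n → ℕ) : List (Σ k, Fin (s k)) :=
  (List.finRange n).flatMap fun k => (List.finRange (s k)).map fun a => ⟨k, a⟩

theorem mem_starEdges (s : Fin n → ℕ) (e : Σ k, Fin (s k)) : e ∈ starEdges s := by
  simp only [starEdges, List.mem_flatMap, List.mem_map, List.mem_finRange, true_and]
  exact ⟨e.1, e.2, rfl⟩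

theorem nodup_starEdges (s : Fin n → ℕ) : (starEdges s).Nodup := by
  refine List.nodup_flatMap.2 ⟨fun k _ => ?_, ?_⟩
  · exact (List.nodup_finRange _).map fun a b h => by simpa using h
  · refine (List.nodup_finRange n).imp fun {k l} hkl => ?_
    rw [Function.onFun, List.disjoint_left]
    intro e h1 h2
    obtain ⟨a, -, rfl⟩ := List.mem_map.1 h1
    obtain ⟨b, -, hb⟩ := List.mem_map.1 h2
    exact hkl (congrArg Sigma.fst hb).symm

/-- The function attached to a vertex: a coordinate of a polyvector field at a vertex of the first
type, and one of the functions `f_j` at a vertex of the second type. -/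
def vertexField (s : Fin n → ℕ) (γ : Fin n → Polyvector d 𝕜) (f : Fin m → (Fin d → ℝ) → 𝕜)
    (I : (Σ k, Fin (s k)) → Fin d) : Fin n ⊕ Fin m → (Fin d → ℝ) → 𝕜 :=
  Sum.elim (fun k y => (γ k).comp (s k) y (fun a => coordCovector (I ⟨k, a⟩))) f

/-- The polydifferential operator of `graphOperator`, for an arbitrary map `τ` from the edges to
the vertices: loops and multiple edges are allowed. -/
def targetOperator (s : Fin n → ℕ) (τ : (Σ k, Fin (s k)) → Fin n ⊕ Fin m)
    (γ : Fin n → Polyvector d 𝕜) (f : Fin m → (Fin d → ℝ) → 𝕜) (x : Fin d → ℝ) : 𝕜 :=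
  ∑ I : (Σ k, Fin (s k)) → Fin d,
    ∏ u, iterPartial (((starEdges s).filter fun e => τ e = u).map I) (vertexField s γ f I u) x

theorem graphOperator_eq_targetOperator (Γ : AdmissibleGraph n m) (γ : Fin n → Polyvector d 𝕜)
    (f : Fin m → (Fin d → ℝ) → 𝕜) :
    graphOperator Γ γ f = targetOperator Γ.star (fun e => Γ.target e.1 e.2) γ f := by
  funext x
  refine Finset.sum_congr rfl fun I _ => ?_
  rw [Fintype.prod_sum_type]
  rfl

variable {s : Fin n → ℕ} {γ : Fin n → Polyvector d 𝕜} {f : Fin m → (Fin d → ℝ) → 𝕜}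

theorem Polyvector.contDiff_comp_apply (γ : Polyvector d 𝕜) (k : ℕ)
    (v : Fin k → (Fin d → ℝ) →L[ℝ] ℝ) : ContDiff ℝ ∞ (fun y => γ.comp k y v) := by
  let A : (((Fin d → ℝ) →L[ℝ] ℝ) [⋀^Fin k]→L[ℝ] 𝕜) →L[ℝ] 𝕜 :=
    ContinuousAlternatingMap.apply ℝ ((Fin d → ℝ) →L[ℝ] ℝ) 𝕜 v
  exact A.contDiff.comp (γ.smooth k)

theorem contDiff_vertexField (hf : ∀ j, ContDiff ℝ ∞ (f j)) (I : (Σ k, Fin (s k)) → Fin d)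
    (u : Fin n ⊕ Fin m) : ContDiff ℝ ∞ (vertexField s γ f I u) := by
  rcases u with k | j
  · exact (γ k).contDiff_comp_apply _ _
  · exact hf j

/-- For two edges with the same start and the same end the operator vanishes, as a skew-symmetric
tensor is contracted with commuting derivatives. -/
theorem targetOperator_eq_zero_of_multiple (hf : ∀ j, ContDiff ℝ ∞ (f j))
    (τ : (Σ k, Fin (s k)) → Fin n ⊕ Fin m) {k : Fin n} {a b : Fin (s k)} (hab : a ≠ b)
    (h : τ ⟨k, a⟩ = τ ⟨k, b⟩) : targetOperator s τ γ f = 0 := by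
  funext x
  -- exchanging the indices of the two edges reverses the sign of every summand
  let σ : Equiv.Perm (Σ k, Fin (s k)) := Equiv.swap ⟨k, a⟩ ⟨k, b⟩
  have hσ : ∀ e, τ (σ e) = τ e := by
    intro e
    by_cases h1 : e = ⟨k, a⟩
    · subst h1
      simp [σ, h]
    by_cases h2 : e = ⟨k, b⟩
    · subst h2
      simp [σ, h]
    simp [σ, Equiv.swap_apply_of_ne_of_ne h1 h2]
  have hlist : ∀ (I : (Σ k, Fin (s k)) → Fin d) u,
      (((starEdges s).filter fun e => τ e = u).map (I ∘ σ)).Perm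
      (((starEdges s).filter fun e => τ e = u).map I) := by
    intro I u
    rw [← List.map_map]
    refine List.Perm.map I ?_
    rw [List.perm_ext_iff_of_nodup (((nodup_starEdges s).filter _).map σ.injective)
      ((nodup_starEdges s).filter _)]
    intro e
    simp only [List.mem_map, List.mem_filter, mem_starEdges, true_and, decide_eq_true_eq]
    constructor
    · rintro ⟨e', h1, rfl⟩
      rw [hσ, h1]
    · intro h1
      exact ⟨σ e, by rw [hσ, h1], by simp [σ]⟩
  have hfield : ∀ (I : (Σ k, Fin (s k)) → Fin d) u, vertexField s γ f (I ∘ σ) u =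
      if u = Sum.inl k then fun y => - vertexField s γ f I u y else vertexField s γ f I u := by
    intro I u
    rcases u with l | j
    · by_cases hl : l = k
      · subst hl
        rw [if_pos rfl]
        funext y
        have h1 := ((γ l).comp (s l) y).toAlternatingMap.map_swap
          (fun c => coordCovector (I ⟨l, c⟩)) hab
        refine Eq.trans ?_ h1
        refine congrArg ((γ l).comp (s l) y) ?_
        funext c
        have hinj : Function.Injective (fun c : Fin (s l) => (⟨l, c⟩ : Σ k, Fin (s k))) :=
          fun c c' hc => by simpa using hc
        exact congrArg (fun e => coordCovector (I e)) (hinj.swap_apply a b c)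
      · rw [if_neg (by simpa using hl)]
        funext y
        refine congrArg ((γ l).comp (s l) y) ?_
        funext c
        have : σ ⟨l, c⟩ = ⟨l, c⟩ := Equiv.swap_apply_of_ne_of_ne
          (fun hc => hl (congrArg Sigma.fst hc)) (fun hc => hl (congrArg Sigma.fst hc))
        simp [this]
    · rfl
  have hterm : ∀ I : (Σ k, Fin (s k)) → Fin d,
      (∏ u, iterPartial (((starEdges s).filter fun e => τ e = u).map (I ∘ σ))
        (vertexField s γ f (I ∘ σ) u) x) =
      - ∏ u, iterPartial (((starEdges s).filter fun e => τ e = u).map I)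
        (vertexField s γ f I u) x := by
    intro I
    have h1 : ∀ u, iterPartial (((starEdges s).filter fun e => τ e = u).map (I ∘ σ))
        (vertexField s γ f (I ∘ σ) u) x = (if u = Sum.inl k then -1 else 1) *
        iterPartial (((starEdges s).filter fun e => τ e = u).map I)
        (vertexField s γ f I u) x := by
      intro u
      rw [iterPartial_perm (contDiff_vertexField hf _ _) (hlist I u), hfield I u]
      split_ifs
      · rw [iterPartial_neg]
        ring
      · ring
    rw [Finset.prod_congr rfl fun u _ => h1 u, Finset.prod_mul_distrib, Finset.prod_ite_eq']
    simp
  have hsum : targetOperator s τ γ f x = - targetOperator s τ γ f x := by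
    conv_lhs => rw [targetOperator]
    rw [targetOperator, ← Finset.sum_neg_distrib,
      ← (Equiv.arrowCongr σ (Equiv.refl (Fin d))).sum_comp]
    exact Finset.sum_congr rfl fun I _ => hterm I
  exact self_eq_neg.1 hsum

/-- The edges that end at `u` when the end of `e₀` is changed to `v`. The lists agree up to their
order only, which is irrelevant as partial derivatives commute. -/
theorem filter_update_perm (s : Fin n → ℕ) (τ : (Σ k, Fin (s k)) → Fin n ⊕ Fin m)
    (e₀ : Σ k, Fin (s k)) (v u : Fin n ⊕ Fin m) :
    ((starEdges s).filter fun e => Function.update τ e₀ v e = u).Perm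
      (if u = v then e₀ :: (starEdges s).filter fun e => e ≠ e₀ ∧ τ e = u
        else (starEdges s).filter fun e => e ≠ e₀ ∧ τ e = u) := by
  split_ifs with huv
  · rw [List.perm_ext_iff_of_nodup ((nodup_starEdges s).filter _)
      (List.nodup_cons.2 ⟨by simp, (nodup_starEdges s).filter _⟩)]
    intro e
    by_cases he : e = e₀
    · subst he
      simp [mem_starEdges, huv]
    · simp [mem_starEdges, he]
  · rw [List.perm_ext_iff_of_nodup ((nodup_starEdges s).filter _)
      ((nodup_starEdges s).filter _)]
    intro e
    by_cases he : e = e₀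
    · subst he
      simp [mem_starEdges, Ne.symm huv]
    · simp [mem_starEdges, he]

theorem hasCompactSupport_prod_of_mem {ι : Type*} {t : Finset ι}
    {g : ι → (Fin d → ℝ) → 𝕜} {j₀ : ι} (hj₀ : j₀ ∈ t) (hg : HasCompactSupport (g j₀)) :
    HasCompactSupport (fun x => ∏ u ∈ t, g u x) := by
  refine hg.mono fun x hx => ?_
  rw [Function.mem_support] at hx ⊢
  exact Finset.prod_ne_zero_iff.1 hx j₀ hj₀

theorem integrable_of_contDiff_of_hasCompactSupport {g : (Fin d → ℝ) → 𝕜} (hg : ContDiff ℝ ∞ g)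
    (hc : HasCompactSupport g) : MeasureTheory.Integrable g :=
  hg.continuous.integrable_of_hasCompactSupport hc

theorem contDiff_targetOperator (hf : ∀ j, ContDiff ℝ ∞ (f j))
    (τ : (Σ k, Fin (s k)) → Fin n ⊕ Fin m) : ContDiff ℝ ∞ (targetOperator s τ γ f) :=
  ContDiff.sum fun I _ => contDiff_prod fun u _ =>
    contDiff_iterPartial (contDiff_vertexField hf I u) _

theorem hasCompactSupport_targetOperator (hfc : ∀ j, HasCompactSupport (f j)) (j₀ : Fin m)
    (τ : (Σ k, Fin (s k)) → Fin n ⊕ Fin m) : HasCompactSupport (targetOperator s τ γ f) := by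
  refine HasCompactSupport.of_support_subset_isCompact (hfc j₀) fun x hx => ?_
  obtain ⟨I, -, hI⟩ := Finset.exists_ne_zero_of_sum_ne_zero hx
  exact tsupport_iterPartial_subset _ _
    (subset_tsupport _ (Finset.prod_ne_zero_iff.1 hI (Sum.inr j₀) (Finset.mem_univ _)))

/-- Summation over all ends of the edge `e₀` produces, by the Leibniz rule, a derivative of the
product of the factors of the other vertices. An integration by parts moves it to the factor of
the start of `e₀`, where it becomes a divergence. -/
theorem sum_integral_targetOperator_update {Ω : (Fin d → ℝ) [⋀^Fin d]→L[ℝ] ℝ} (hΩ : Ω ≠ 0)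
    (hγ : ∀ i, (γ i).IsDivFree Ω) (hf : ∀ j, ContDiff ℝ ∞ (f j))
    (hfc : ∀ j, HasCompactSupport (f j)) (j₀ : Fin m) (τ : (Σ k, Fin (s k)) → Fin n ⊕ Fin m)
    (e₀ : Σ k, Fin (s k)) :
    ∑ v ∈ Finset.univ.erase (Sum.inl e₀.1),
      ∫ x, targetOperator s (Function.update τ e₀ v) γ f x = 0 := by
  obtain ⟨k₀, a₀⟩ := e₀
  let U : Finset (Fin n ⊕ Fin m) := Finset.univ.erase (Sum.inl k₀)
  -- `h I u` is the factor of the vertex `u`, without the derivative that belongs to `e₀`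
  let E : Fin n ⊕ Fin m → List (Σ k, Fin (s k)) := fun u =>
    (starEdges s).filter fun e => e ≠ ⟨k₀, a₀⟩ ∧ τ e = u
  let h : ((Σ k, Fin (s k)) → Fin d) → Fin n ⊕ Fin m → (Fin d → ℝ) → 𝕜 := fun I u =>
    iterPartial ((E u).map I) (vertexField s γ f I u)
  have hh : ∀ I u, ContDiff ℝ ∞ (h I u) := fun I u =>
    contDiff_iterPartial (contDiff_vertexField hf I u) _
  let H : ((Σ k, Fin (s k)) → Fin d) → (Fin d → ℝ) → 𝕜 := fun I x => ∏ u ∈ U, h I u x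
  have hH : ∀ I, ContDiff ℝ ∞ (H I) := fun I => contDiff_prod fun u _ => hh I u
  have hHc : ∀ I, HasCompactSupport (H I) := fun I =>
    hasCompactSupport_prod_of_mem (j₀ := Sum.inr j₀) (by simp [U])
      (hasCompactSupport_iterPartial (hfc j₀) _)
  have hfactor : ∀ I v u x, iterPartial (((starEdges s).filter fun e =>
      Function.update τ ⟨k₀, a₀⟩ v e = u).map I) (vertexField s γ f I u) x =
      if u = v then fderiv ℝ (h I u) x (coordVector (I ⟨k₀, a₀⟩)) else h I u x := by
    intro I v u x
    rw [iterPartial_perm (contDiff_vertexField hf I u) ((filter_update_perm s τ _ v u).map I)]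
    split_ifs <;> rfl
  have hprod : ∀ I, ∀ v ∈ U, ∀ x, ∏ u, iterPartial (((starEdges s).filter fun e =>
      Function.update τ ⟨k₀, a₀⟩ v e = u).map I) (vertexField s γ f I u) x =
      h I (Sum.inl k₀) x * ((∏ u ∈ U.erase v, h I u x) *
        fderiv ℝ (h I v) x (coordVector (I ⟨k₀, a₀⟩))) := by
    intro I v hv x
    rw [Finset.prod_congr rfl fun u _ => hfactor I v u x,
      ← Finset.mul_prod_erase _ _ (Finset.mem_univ (Sum.inl k₀)),
      ← Finset.mul_prod_erase _ _ hv, if_neg (Finset.ne_of_mem_erase hv).symm, if_pos rfl,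
      mul_comm (∏ u ∈ U.erase v, h I u x)]
    congr 2
    exact Finset.prod_congr rfl fun u hu => if_neg (Finset.ne_of_mem_erase hu)
  have hLeibniz : ∀ x, ∑ v ∈ U, targetOperator s (Function.update τ ⟨k₀, a₀⟩ v) γ f x =
      ∑ I, h I (Sum.inl k₀) x * fderiv ℝ (H I) x (coordVector (I ⟨k₀, a₀⟩)) := by
    intro x
    simp only [targetOperator]
    rw [Finset.sum_comm]
    refine Finset.sum_congr rfl fun I _ => ?_
    rw [Finset.sum_congr rfl fun v hv => hprod I v hv x, ← Finset.mul_sum]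
    congr 1
    rw [(HasFDerivAt.finsetProd (u := U) (g := h I) (x := x) fun u _ =>
      ((hh I u).differentiable (by simp) x).hasFDerivAt).fderiv]
    simp
  have hint : ∀ I, MeasureTheory.Integrable (fun x =>
      h I (Sum.inl k₀) x * fderiv ℝ (H I) x (coordVector (I ⟨k₀, a₀⟩))) := fun I =>
    integrable_of_contDiff_of_hasCompactSupport
      ((hh I _).mul (contDiff_fderiv_coordVector (hH I) _))
      (((hHc I).fderiv_apply ℝ _).mul_left)
  have hint' : ∀ I, MeasureTheory.Integrable (fun x =>
      fderiv ℝ (h I (Sum.inl k₀)) x (coordVector (I ⟨k₀, a₀⟩)) * H I x) := fun I =>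
    integrable_of_contDiff_of_hasCompactSupport
      ((contDiff_fderiv_coordVector (hh I _) _).mul (hH I)) (hHc I).mul_left
  have hparts : ∀ I, ∫ x, h I (Sum.inl k₀) x * fderiv ℝ (H I) x (coordVector (I ⟨k₀, a₀⟩)) =
      - ∫ x, fderiv ℝ (h I (Sum.inl k₀)) x (coordVector (I ⟨k₀, a₀⟩)) * H I x := fun I =>
    integral_mul_fderiv_eq_neg_fderiv_mul_of_integrable (hint' I) (hint I)
      (integrable_of_contDiff_of_hasCompactSupport ((hh I _).mul (hH I)) (hHc I).mul_left)
      (fun x _ => (hh I _).differentiable (by simp) x)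
      (fun x _ => (hH I).differentiable (by simp) x)
  have hdiv : ∀ x, ∑ I, fderiv ℝ (h I (Sum.inl k₀)) x (coordVector (I ⟨k₀, a₀⟩)) * H I x = 0 := by
    intro x
    -- only the factor of `k₀` depends on the index of `e₀`
    refine sum_pi_eq_zero_of_sum_update ⟨k₀, a₀⟩ _ fun I => ?_
    have hE : ∀ u i, (E u).map (Function.update I ⟨k₀, a₀⟩ i) = (E u).map I := by
      intro u i
      refine List.map_congr_left fun e he => Function.update_of_ne ?_ _ _
      exact (of_decide_eq_true (List.mem_filter.1 he).2).1
    have hHu : ∀ i, H (Function.update I ⟨k₀, a₀⟩ i) x = H I x := by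
      intro i
      refine Finset.prod_congr rfl fun u hu => ?_
      simp only [h, hE]
      congr 1
      rcases u with k | j
      · have hk : k ≠ k₀ := by simpa [U] using hu
        funext y
        refine congrArg ((γ k).comp (s k) y) ?_
        funext a
        rw [Function.update_of_ne]
        exact fun hc => hk (congrArg Sigma.fst hc)
      · rfl
    simp only [hHu, Function.update_self, ← Finset.sum_mul]
    have hcoord : ∀ i, vertexField s γ f (Function.update I ⟨k₀, a₀⟩ i) (Sum.inl k₀) =
        fun y => (γ k₀).comp (s k₀) y (fun c => coordCovector
          (Function.update (fun a => I ⟨k₀, a⟩) a₀ i c)) := by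
      intro i
      funext y
      refine congrArg ((γ k₀).comp (s k₀) y) ?_
      funext c
      congr 1
      by_cases hc : c = a₀
      · subst hc
        simp
      · rw [Function.update_of_ne hc, Function.update_of_ne]
        exact fun h => hc (by simpa using h)
    have hsmooth : ∀ i, ContDiff ℝ ∞ (fun y => (γ k₀).comp (s k₀) y (fun c => coordCovector
          (Function.update (fun a => I ⟨k₀, a⟩) a₀ i c))) := fun i =>
      (γ k₀).contDiff_comp_apply _ _
    have hmove : ∀ i, fderiv ℝ (h (Function.update I ⟨k₀, a₀⟩ i) (Sum.inl k₀)) x (coordVector i) =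
        iterPartial ((E (Sum.inl k₀)).map I) (fun y => fderiv ℝ (fun y =>
          (γ k₀).comp (s k₀) y (fun c => coordCovector
          (Function.update (fun a => I ⟨k₀, a⟩) a₀ i c))) y (coordVector i)) x := by
      intro i
      have h1 := congrFun (iterPartial_perm (hsmooth i)
        (List.perm_append_singleton i ((E (Sum.inl k₀)).map I))) x
      simp only [h, hE, hcoord]
      refine h1.symm.trans ?_
      simp [iterPartial]
    rw [Finset.sum_congr rfl fun i _ => hmove i]
    have h2 := congrFun (iterPartial_sum Finset.univ
      (fun i _ => contDiff_fderiv_coordVector (hsmooth i) (coordVector i))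
      ((E (Sum.inl k₀)).map I)) x
    simp only [(hγ k₀).sum_fderiv_update hΩ] at h2
    rw [← h2, iterPartial_zero, zero_mul]
  rw [← MeasureTheory.integral_finsetSum _ fun v _ =>
    integrable_of_contDiff_of_hasCompactSupport (contDiff_targetOperator hf _)
      (hasCompactSupport_targetOperator hfc j₀ _)]
  refine (MeasureTheory.integral_congr_ae (.of_forall hLeibniz)).trans ?_
  rw [MeasureTheory.integral_finsetSum _ fun I _ => hint I,
    Finset.sum_congr rfl fun I _ => hparts I, Finset.sum_neg_distrib,
    ← MeasureTheory.integral_finsetSum _ fun I _ => hint' I]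
  simp [hdiv]

end TargetOperator

/-! ### Integrability of determinants of angle forms -/

section AngleForms

open MeasureTheory Complex

variable {Y V : Type*} [NormedAddCommGroup Y] [NormedSpace ℝ Y] [NormedAddCommGroup V]
  [NormedSpace ℝ V]

theorem dArg_apply (F : Y → ℂ) (y v : Y) : dArg F y v = ((F y)⁻¹ * fderiv ℝ F y v).im := rfl

theorem hasFDerivAt_arg {F : Y → ℂ} {y : Y} (hF : DifferentiableAt ℝ F y) {c : ℂ}
    (hc : c * F y ∈ slitPlane) : HasFDerivAt (fun z => arg (c * F z)) (dArg F y) y := by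
  have hc0 : c ≠ 0 := by
    rintro rfl
    simp at hc
  have h1 := ((hasDerivAt_log hc).hasFDerivAt.restrictScalars ℝ).comp y
    (hF.hasFDerivAt.const_mul c)
  have h2 := imCLM.hasFDerivAt.comp y h1
  have h3 : (fun x => imCLM (log (c * F x))) = fun z => arg (c * F z) := by
    funext z
    exact log_im _
  rw [Function.comp_def, Function.comp_def, h3] at h2
  refine h2.congr_fderiv ?_
  ext v
  simp only [dArg, ContinuousLinearMap.comp_apply, smul_apply, smul_eq_mul]
  congr 1
  simp
  field_simp

/-- If `c * u` and `c * w` have the same argument, then `w / u` is real. -/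
theorem im_inv_mul_of_arg_eq {c u w : ℂ} (hc : c ≠ 0) (hu : u ≠ 0) (hw : w ≠ 0)
    (h : arg (c * u) = arg (c * w)) : (u⁻¹ * w).im = 0 := by
  have hcu := mul_ne_zero hc hu
  have hcw := mul_ne_zero hc hw
  have h1 := (arg_eq_arg_iff hcu hcw).1 h
  have h2 : u⁻¹ * w = ((‖c * w‖ / ‖c * u‖ : ℝ) : ℂ) := by
    push_cast
    have h3 : (‖c * w‖ / ‖c * u‖ : ℂ) * u = w := by
      apply mul_left_cancel₀ hc
      linear_combination h1
    conv_lhs => rw [← h3]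
    field_simp
  rw [h2, ofReal_im]

theorem measurable_dArg_apply [MeasurableSpace Y] [BorelSpace Y] [FiniteDimensional ℝ Y]
    {F : Y → ℂ} (hF : Measurable F) (v : Y) : Measurable fun y => dArg F y v := by
  have := FiniteDimensional.proper_rclike ℝ Y
  exact measurable_im.comp (hF.inv.mul (measurable_fderiv_apply_const ℝ F v))

theorem measurable_det {Z : Type*} [MeasurableSpace Z] {K : ℕ} {M : Z → Matrix (Fin K) (Fin K) ℝ}
    (hM : ∀ i j, Measurable fun z => M z i j) : Measurable fun z => (M z).det := by
  simp only [Matrix.det_apply]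
  exact Finset.measurable_sum _ fun σ _ =>
    (Finset.measurable_prod _ fun i _ => hM (σ i) i).const_smul _

/-- The determinant of the angle forms of functions that are real-affine in injective coordinates
`Ψ` is integrable. Where it does not vanish, the angles determine the point, as fixing them amounts
to a system of affine equations for `Ψ` with a unique solution. So, up to the choice of branches,
the integral of its absolute value is the volume of a set of angles. -/
theorem integrableOn_det_dArg_affine [FiniteDimensional ℝ Y] [MeasurableSpace Y] [BorelSpace Y]
    (μ : Measure Y) [μ.IsAddHaarMeasure] [MeasurableSpace V] [BorelSpace V] {K : ℕ}
    (b : Module.Basis (Fin K) ℝ Y) {s : Set Y} (hs : MeasurableSet s) {Ψ : Y → V}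
    {Ψ' : Y → Y →L[ℝ] V} (hΨ : ∀ y ∈ s, HasFDerivAt Ψ (Ψ' y) y)
    (hsurj : ∀ y ∈ s, Function.Surjective (Ψ' y)) (hinj : Set.InjOn Ψ s) (hmeas : Measurable Ψ)
    (L : Fin K → V →L[ℝ] ℂ) (c : Fin K → ℂ) (hne : ∀ a, ∀ y ∈ s, L a (Ψ y) + c a ≠ 0) :
    IntegrableOn (fun y => (Matrix.of fun a j : Fin K =>
      dArg (fun z => L a (Ψ z) + c a) y (b j)).det) s μ := by
  set F : Fin K → Y → ℂ := fun a z => L a (Ψ z) + c a with hFdef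
  set g : Y → ℝ := fun y => (Matrix.of fun a j : Fin K => dArg (F a) y (b j)).det with hg
  have hFd : ∀ a, ∀ y ∈ s, HasFDerivAt (F a) ((L a).comp (Ψ' y)) y := fun a y hy =>
    ((L a).hasFDerivAt.comp y (hΨ y hy)).add_const (c a)
  have hFm : ∀ a, Measurable (F a) := fun a => ((L a).measurable.comp hmeas).add_const _
  have hgm : Measurable g := measurable_det fun a j => measurable_dArg_apply (hFm a) (b j)
  -- `arg` is smooth off the negative axis only; a choice of signs moves the values of the `F a`
  -- away from it
  let t : (Fin K → ℤˣ) → Set Y := fun ε =>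
    s ∩ {y | g y ≠ 0} ∩ {y | ∀ a, (((ε a : ℤ) : ℂ)) * F a y ∈ slitPlane}
  have ht : ∀ ε, MeasurableSet (t ε) := by
    intro ε
    refine (hs.inter (hgm (measurableSet_singleton 0).compl)).inter ?_
    rw [Set.ofPred_forall]
    exact MeasurableSet.iInter fun a =>
      ((hFm a).const_mul _) isOpen_slitPlane.measurableSet
  have hcover : s ⊆ (s ∩ {y | g y = 0}) ∪ ⋃ ε, t ε := by
    intro y hy
    by_cases h0 : g y = 0
    · exact Or.inl ⟨hy, h0⟩
    right
    have : ∀ a, ∃ e : ℤˣ, ((e : ℤ) : ℂ) * F a y ∈ slitPlane := by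
      intro a
      rcases mem_slitPlane_or_neg_mem_slitPlane (hne a y hy) with h | h
      · exact ⟨1, by simpa using h⟩
      · exact ⟨-1, by simpa only [Units.val_neg, Units.val_one, Int.cast_neg, Int.cast_one,
          neg_one_mul] using h⟩
    choose ε hε using this
    exact Set.mem_iUnion.2 ⟨ε, ⟨hy, h0⟩, hε⟩
  refine IntegrableOn.mono_set (IntegrableOn.union ?_ ?_) hcover
  · refine (integrableOn_zero (μ := μ)).congr_fun (fun y hy => hy.2.symm)
      (hs.inter (hgm (measurableSet_singleton 0)))
  rw [integrableOn_finite_iUnion]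
  intro ε
  let Φ : Y → Y := fun y => ∑ a, arg (((ε a : ℤ) : ℂ) * F a y) • b a
  let Φ' : Y → Y →L[ℝ] Y := fun y => ∑ a, (dArg (F a) y).smulRight (b a)
  have hε0 : ∀ a, ((ε a : ℤ) : ℂ) ≠ 0 := fun a => by
    exact_mod_cast (ε a).ne_zero
  have hΦ : ∀ y ∈ t ε, HasFDerivWithinAt Φ (Φ' y) (t ε) y := fun y hy =>
    (HasFDerivAt.fun_sum fun a _ => (hasFDerivAt_arg (hFd a y hy.1.1).differentiableAt
      (hy.2 a)).smul_const (b a)).hasFDerivWithinAt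
  have hdet : ∀ y, (Φ' y).det = g y := by
    intro y
    rw [ContinuousLinearMap.det, ← LinearMap.det_toMatrix b]
    congr 1
    ext i j
    simp [LinearMap.toMatrix_apply, Φ', Finsupp.single_apply]
  have hΦinj : Set.InjOn Φ (t ε) := by
    intro y hy z hz hyz
    have harg : ∀ a, arg (((ε a : ℤ) : ℂ) * F a y) = arg (((ε a : ℤ) : ℂ) * F a z) := by
      intro a
      have h := congrArg (fun x => b.repr x a) hyz
      simpa [Φ, Finsupp.single_apply] using h
    obtain ⟨v, hv⟩ := hsurj y hy.1.1 (Ψ z - Ψ y)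
    -- `v` solves the homogeneous linear system, since `F a z / F a y` is real for every `a`
    have hzero : ∀ a, dArg (F a) y v = 0 := by
      intro a
      have hFy := hne a y hy.1.1
      rw [dArg_apply, (hFd a y hy.1.1).fderiv, ContinuousLinearMap.comp_apply, hv]
      have h1 : L a (Ψ z - Ψ y) = F a z - F a y := by simp [hFdef]
      have h2 : (F a y)⁻¹ * F a y = 1 := inv_mul_cancel₀ hFy
      rw [h1, mul_sub, h2, sub_im, one_im, sub_zero]
      exact im_inv_mul_of_arg_eq (hε0 a) hFy (hne a z hz.1.1) (harg a)
    have hv0 : v = 0 := by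
      have hunit : (Matrix.of fun a j : Fin K => dArg (F a) y (b j)).det ≠ 0 := hy.1.2
      have h1 : (Matrix.of fun a j : Fin K => dArg (F a) y (b j)).mulVec (b.repr v) = 0 := by
        funext a
        rw [Pi.zero_apply, ← hzero a]
        conv_rhs => rw [← b.sum_repr v, map_sum]
        simp only [Matrix.mulVec, dotProduct, Matrix.of_apply, map_smul, smul_eq_mul, mul_comm]
      have h2 := Matrix.eq_zero_of_mulVec_eq_zero hunit h1
      exact b.repr.map_eq_zero_iff.1 (DFunLike.coe_injective h2)
    rw [hv0, map_zero] at hv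
    exact hinj hy.1.1 hz.1.1 (sub_eq_zero.1 hv.symm).symm
  refine ⟨hgm.aestronglyMeasurable, ?_⟩
  have harea := lintegral_abs_det_fderiv_eq_addHaar_image μ (ht ε) hΦ hΦinj
  have hfin : μ (Φ '' t ε) < ⊤ := by
    have hcpt : IsCompact ((fun x : Fin K → ℝ => ∑ a, x a • b a) ''
        (Set.univ.pi fun _ => Set.Icc (-Real.pi) Real.pi)) :=
      (isCompact_univ_pi fun _ => isCompact_Icc).image (by fun_prop)
    refine (measure_mono ?_).trans_lt hcpt.measure_lt_top
    rintro _ ⟨y, -, rfl⟩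
    exact ⟨fun a => arg (((ε a : ℤ) : ℂ) * F a y),
      fun a _ => ⟨(neg_pi_lt_arg _).le, arg_le_pi _⟩, rfl⟩
  rw [hasFiniteIntegral_iff_enorm]
  simp only [Real.enorm_eq_ofReal_abs]
  simp only [hdet] at harea
  rw [harea]
  exact hfin

/-- The 1-forms that agree on `s` with the angle form of a non-vanishing function of the form
`L ∘ Ψ + c`. -/
def affineAngleForms (s : Set Y) (Ψ : Y → V) : Set (Y → Y →L[ℝ] ℝ) :=
  {η | ∃ (L : V →L[ℝ] ℂ) (c : ℂ), (∀ y ∈ s, L (Ψ y) + c ≠ 0) ∧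
    ∀ y ∈ s, η y = dArg (fun z => L (Ψ z) + c) y}

/-- The linear combinations with constant coefficients of affine angle forms. -/
def angleFormSpan (s : Set Y) (Ψ : Y → V) : Submodule ℝ (Y → Y →L[ℝ] ℝ) :=
  Submodule.span ℝ (affineAngleForms s Ψ)

/-- Membership in `angleFormSpan s Ψ` depends on the values on `s` only, as a form that vanishes on
`s` agrees there with the angle form of a constant. -/
theorem mem_angleFormSpan_congr {s : Set Y} {Ψ : Y → V} {η η' : Y → Y →L[ℝ] ℝ}
    (hη : η ∈ angleFormSpan s Ψ) (h : ∀ y ∈ s, η' y = η y) : η' ∈ angleFormSpan s Ψ := by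
  have h0 : η' - η ∈ angleFormSpan s Ψ := by
    refine Submodule.subset_span ⟨0, 1, by simp, fun y hy => ?_⟩
    ext v
    simp [h y hy, dArg_apply]
  simpa using Submodule.add_mem _ h0 hη

/-- The integrability for linear combinations, by expanding the determinant row by row. -/
theorem integrableOn_det_of_mem_angleFormSpan [FiniteDimensional ℝ Y] [MeasurableSpace Y]
    [BorelSpace Y] (μ : Measure Y) [μ.IsAddHaarMeasure] [MeasurableSpace V] [BorelSpace V] {K : ℕ}
    (b : Module.Basis (Fin K) ℝ Y) {s : Set Y} (hs : MeasurableSet s) {Ψ : Y → V}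
    {Ψ' : Y → Y →L[ℝ] V} (hΨ : ∀ y ∈ s, HasFDerivAt Ψ (Ψ' y) y)
    (hsurj : ∀ y ∈ s, Function.Surjective (Ψ' y)) (hinj : Set.InjOn Ψ s) (hmeas : Measurable Ψ)
    (η : Fin K → Y → Y →L[ℝ] ℝ) (hη : ∀ a, η a ∈ angleFormSpan s Ψ) :
    IntegrableOn (fun y => (Matrix.of fun a j : Fin K => η a y (b j)).det) s μ := by
  suffices h : ∀ (T : Finset (Fin K)) (η : Fin K → Y → Y →L[ℝ] ℝ),
      (∀ a ∈ T, η a ∈ angleFormSpan s Ψ) → (∀ a ∉ T, η a ∈ affineAngleForms s Ψ) →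
      IntegrableOn (fun y => (Matrix.of fun a j : Fin K => η a y (b j)).det) s μ from
    h Finset.univ η (fun a _ => hη a) (fun a ha => absurd (Finset.mem_univ a) ha)
  intro T
  induction T using Finset.induction_on with
  | empty =>
    intro η _ hη
    choose L c hne heq using fun a => hη a (Finset.notMem_empty a)
    refine (integrableOn_det_dArg_affine μ b hs hΨ hsurj hinj hmeas L c hne).congr_fun
      (fun y hy => ?_) hs
    simp only [heq _ y hy]
  | insert a T ha ih =>
    intro η h1 h2
    -- the determinant as a function of the row `a`
    have hrow : ∀ (x : Y → Y →L[ℝ] ℝ) y, (Matrix.of fun i j : Fin K =>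
        Function.update η a x i y (b j)).det =
        Matrix.detRowAlternating (Function.update (fun i j => η i y (b j)) a
          (fun j => x y (b j))) := by
      intro x y
      refine congrArg Matrix.det ?_
      ext i j
      by_cases hi : i = a
      · subst hi
        simp
      · simp [hi]
    have key : ∀ x ∈ angleFormSpan s Ψ, IntegrableOn (fun y => (Matrix.of fun i j : Fin K =>
        Function.update η a x i y (b j)).det) s μ := by
      intro x hx
      induction hx using Submodule.span_induction with
      | mem x hx =>
        refine ih _ (fun i hi => ?_) (fun i hi => ?_)
        · have : i ≠ a := fun h => ha (h ▸ hi)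
          rw [Function.update_of_ne this]
          exact h1 i (Finset.mem_insert_of_mem hi)
        · by_cases hia : i = a
          · subst hia
            simpa using hx
          · rw [Function.update_of_ne hia]
            exact h2 i (by simp [hia, hi])
      | zero =>
        refine integrableOn_zero.congr_fun (fun y _ => ?_) hs
        rw [hrow]
        symm
        exact Matrix.detRowAlternating.map_coord_zero a (by simp; rfl)
      | add x x' _ _ hx hx' =>
        refine (hx.add hx').congr_fun (fun y _ => ?_) hs
        simp only [Pi.add_apply, hrow]
        symm
        exact Matrix.detRowAlternating.map_update_add _ a _ _
      | smul r x _ hx =>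
        refine IntegrableOn.congr_fun (hx.const_mul r) (fun y _ => ?_) hs
        simp only [hrow]
        symm
        exact Matrix.detRowAlternating.map_update_smul _ a r _
    simpa using key (η a) (h1 a (Finset.mem_insert_self a T))

end AngleForms

/-! ### Half-plane coordinates on the slice -/

section HalfPlane

open MeasureTheory Complex

/-- The Cayley transform from the unit disk to the upper half-plane, with `0 ↦ i` and `1 ↦ ∞`. -/
def cayley (w : ℂ) : ℂ := I * (1 + w) / (1 - w)

theorem cayley_add_I {w : ℂ} (hw : w ≠ 1) : cayley w + I = 2 * I / (1 - w) := by
  have : 1 - w ≠ 0 := sub_ne_zero.2 hw.symm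
  rw [cayley]
  field_simp
  ring

theorem cayley_injOn : Set.InjOn cayley {w | w ≠ 1} := by
  intro w hw z hz h
  have h1 : 1 - w ≠ 0 := sub_ne_zero.2 (Ne.symm hw)
  have h2 : 1 - z ≠ 0 := sub_ne_zero.2 (Ne.symm hz)
  rw [cayley, cayley, div_eq_div_iff h1 h2] at h
  have h3 : (2 * I) * (w - z) = 0 := by linear_combination h
  have h4 : (2 * I : ℂ) ≠ 0 := by simp
  exact sub_eq_zero.1 ((mul_eq_zero.1 h3).resolve_left h4)

theorem hasDerivAt_cayley {w : ℂ} (hw : w ≠ 1) :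
    HasDerivAt cayley (2 * I / (1 - w) ^ 2) w := by
  have h1 : 1 - w ≠ 0 := sub_ne_zero.2 hw.symm
  have h := (((hasDerivAt_id w).const_add 1).const_mul I).div ((hasDerivAt_id w).const_sub 1) h1
  refine h.congr_deriv ?_
  simp only [id]
  congr 1
  ring

/-- The real coordinate `-cot (t / 2)` of the boundary point with argument `t`. -/
def boundaryCoord (t : ℝ) : ℝ := -(Real.cos (t / 2) / Real.sin (t / 2))

theorem sin_half_pos {t : ℝ} (h0 : 0 < t) (h1 : t < 2 * Real.pi) : 0 < Real.sin (t / 2) :=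
  Real.sin_pos_of_pos_of_lt_pi (by linarith) (by linarith)

theorem cayley_exp {t : ℝ} (h0 : 0 < t) (h1 : t < 2 * Real.pi) :
    cayley (exp (t * I)) = (boundaryCoord t : ℂ) := by
  have hs : (Real.sin (t / 2) : ℂ) ≠ 0 := by exact_mod_cast (sin_half_pos h0 h1).ne'
  have hE : exp (t * I) = ((Real.cos (t / 2) : ℂ) + Real.sin (t / 2) * I) ^ 2 := by
    rw [ofReal_cos, ofReal_sin, ← exp_mul_I, ← exp_nat_mul]
    congr 1
    push_cast
    ring
  have hsc : (Real.cos (t / 2) : ℂ) ^ 2 + (Real.sin (t / 2) : ℂ) ^ 2 = 1 := by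
    exact_mod_cast Real.cos_sq_add_sin_sq (t / 2)
  have hE0 : (Real.cos (t / 2) : ℂ) + Real.sin (t / 2) * I ≠ 0 := by
    intro h
    rw [h] at hE
    exact exp_ne_zero (t * I) (by rw [hE]; simp)
  rw [boundaryCoord, ofReal_neg, ofReal_div]
  generalize (Real.cos (t / 2) : ℂ) = c at *
  generalize (Real.sin (t / 2) : ℂ) = s at *
  have e1 : 1 + exp (t * I) = 2 * c * (c + s * I) := by
    rw [hE, ← hsc]
    linear_combination s ^ 2 * I_sq
  have e2 : 1 - exp (t * I) = -2 * I * s * (c + s * I) := by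
    rw [hE, ← hsc]
    linear_combination s ^ 2 * I_sq
  rw [cayley, e1, e2, div_eq_iff (mul_ne_zero (mul_ne_zero (by simp) hs) hE0)]
  field_simp

theorem boundaryCoord_injOn : Set.InjOn boundaryCoord (Set.Ioo 0 (2 * Real.pi)) := by
  intro t ht t' ht' h
  have h1 := (sin_half_pos ht.1 ht.2).ne'
  have h2 := (sin_half_pos ht'.1 ht'.2).ne'
  rw [boundaryCoord, boundaryCoord, neg_inj, div_eq_div_iff h1 h2] at h
  have h3 : Real.sin (t' / 2 - t / 2) = 0 := by
    rw [Real.sin_sub]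
    linarith
  have h4 := (Real.sin_eq_zero_iff_of_lt_of_lt (by linarith [ht.1, ht.2, ht'.1, ht'.2])
    (by linarith [ht.1, ht.2, ht'.1, ht'.2])).1 h3
  linarith

theorem hasDerivAt_boundaryCoord {t : ℝ} (h0 : 0 < t) (h1 : t < 2 * Real.pi) :
    HasDerivAt boundaryCoord (1 / (2 * Real.sin (t / 2) ^ 2)) t := by
  have hs := (sin_half_pos h0 h1).ne'
  have hh : HasDerivAt (fun t : ℝ => t / 2) (1 / 2) t := (hasDerivAt_id t).div_const 2
  have h := ((hh.cos).div (hh.sin) hs).neg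
  refine h.congr_deriv ?_
  field_simp
  linear_combination Real.sin_sq_add_cos_sq (t / 2)

variable {n m : ℕ}

theorem isOpen_sliceDomain (n m : ℕ) : IsOpen (sliceDomain n m) := by
  have hI : ∀ i : Fin (n + 1), Continuous fun y : SliceCoord n m => sliceInt y i := by
    intro i
    refine Fin.cases ?_ (fun i => ?_) i
    · exact continuous_const
    · exact (continuous_apply i).comp continuous_fst
  have hA : ∀ j : Fin (m + 1), Continuous fun y : SliceCoord n m => sliceArg y j := by
    intro j
    refine Fin.cases ?_ (fun j => ?_) j
    · exact continuous_const
    · exact (continuous_apply j).comp continuous_snd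
  have h : sliceDomain n m = (⋂ i, {y | ‖sliceInt y i‖ < 1}) ∩
      ((⋂ i, ⋂ j, {y | i ≠ j → sliceInt y i ≠ sliceInt y j}) ∩
      ((⋂ i, ⋂ j, {y | i < j → sliceArg y i < sliceArg y j}) ∩
      ⋂ j, {y | sliceArg y j < 2 * Real.pi})) := by
    ext y
    simp only [sliceDomain, Set.mem_ofPred_eq, Set.mem_inter_iff, Set.mem_iInter]
    refine and_congr Iff.rfl (and_congr ?_ (and_congr ?_ Iff.rfl))
    · exact ⟨fun h i j hij => h.ne hij, fun h i j hij => by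
        by_contra hne
        exact h i j hne hij⟩
    · exact ⟨fun h i j hij => h hij, fun h i j hij => h i j hij⟩
  rw [h]
  refine (isOpen_iInter_of_finite fun i => isOpen_lt (hI i).norm continuous_const).inter
    ((isOpen_iInter_of_finite fun i => isOpen_iInter_of_finite fun j => ?_).inter
    ((isOpen_iInter_of_finite fun i => isOpen_iInter_of_finite fun j => ?_).inter
    (isOpen_iInter_of_finite fun j => isOpen_lt (hA j) continuous_const)))
  · by_cases hij : i = j
    · simp [hij]
    · simpa [hij] using isOpen_ne_fun (hI i) (hI j)
  · by_cases hij : i < j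
    · simpa [hij] using isOpen_lt (hA i) (hA j)
    · simp [hij]

/-- The coordinates of a point of the slice in the upper half-plane model. -/
def halfPlaneCoord (y : SliceCoord n m) : SliceCoord n m :=
  (fun i => cayley (y.1 i), fun j => boundaryCoord (y.2 j))

/-- The derivative of `halfPlaneCoord`. -/
def halfPlaneCoordDeriv (y : SliceCoord n m) : SliceCoord n m →L[ℝ] SliceCoord n m :=
  (ContinuousLinearMap.pi fun i => ((2 * I / (1 - y.1 i) ^ 2) • ContinuousLinearMap.id ℝ ℂ).comp
    ((ContinuousLinearMap.proj i).comp (ContinuousLinearMap.fst ℝ _ _))).prod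
  (ContinuousLinearMap.pi fun j => (1 / (2 * Real.sin (y.2 j / 2) ^ 2)) •
    ((ContinuousLinearMap.proj j).comp (ContinuousLinearMap.snd ℝ _ _)))

theorem sliceDomain_ne_one {y : SliceCoord n m} (hy : y ∈ sliceDomain n m) (i : Fin (n + 1)) :
    sliceInt y i ≠ 1 := by
  intro h
  have := hy.1 i
  simp [h] at this

theorem sliceDomain_arg_mem {y : SliceCoord n m} (hy : y ∈ sliceDomain n m) (j : Fin m) :
    y.2 j ∈ Set.Ioo 0 (2 * Real.pi) :=
  ⟨hy.2.2.1 (Fin.succ_pos j), hy.2.2.2 j.succ⟩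

theorem hasFDerivAt_halfPlaneCoord {y : SliceCoord n m} (hy : y ∈ sliceDomain n m) :
    HasFDerivAt halfPlaneCoord (halfPlaneCoordDeriv y) y := by
  refine HasFDerivAt.prodMk (hasFDerivAt_pi.2 fun i => ?_) (hasFDerivAt_pi.2 fun j => ?_)
  · have h1 := (hasDerivAt_cayley (sliceDomain_ne_one hy i.succ)).hasFDerivAt.restrictScalars ℝ
    let A : SliceCoord n m →L[ℝ] ℂ :=
      (ContinuousLinearMap.proj i).comp (ContinuousLinearMap.fst ℝ _ _)
    have h2 : HasFDerivAt (fun z : SliceCoord n m => z.1 i) A y := A.hasFDerivAt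
    refine (HasFDerivAt.comp y h1 h2).congr_fderiv ?_
    refine ContinuousLinearMap.ext fun v => ?_
    change v.1 i • (2 * I / (1 - y.1 i) ^ 2) = (2 * I / (1 - y.1 i) ^ 2) * v.1 i
    exact mul_comm _ _
  · have h1 := (hasDerivAt_boundaryCoord (sliceDomain_arg_mem hy j).1
      (sliceDomain_arg_mem hy j).2)
    let A : SliceCoord n m →L[ℝ] ℝ :=
      (ContinuousLinearMap.proj j).comp (ContinuousLinearMap.snd ℝ _ _)
    have h2 : HasFDerivAt (fun z : SliceCoord n m => z.2 j) A y := A.hasFDerivAt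
    exact HasDerivAt.comp_hasFDerivAt (h₂ := boundaryCoord) y h1 h2

theorem halfPlaneCoordDeriv_surjective {y : SliceCoord n m} (hy : y ∈ sliceDomain n m) :
    Function.Surjective (halfPlaneCoordDeriv y) := by
  intro v
  refine ⟨(fun i => (2 * I / (1 - y.1 i) ^ 2)⁻¹ * v.1 i,
    fun j => (1 / (2 * Real.sin (y.2 j / 2) ^ 2))⁻¹ * v.2 j), ?_⟩
  refine Prod.ext (funext fun i => ?_) (funext fun j => ?_)
  · have h1 : 1 - y.1 i ≠ 0 := sub_ne_zero.2 (sliceDomain_ne_one hy i.succ).symm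
    have h2 : 2 * I / (1 - y.1 i) ^ 2 ≠ 0 := div_ne_zero (by simp) (pow_ne_zero _ h1)
    exact mul_inv_cancel_left₀ h2 _
  · have h1 := (sin_half_pos (sliceDomain_arg_mem hy j).1 (sliceDomain_arg_mem hy j).2).ne'
    have h2 : 1 / (2 * Real.sin (y.2 j / 2) ^ 2) ≠ 0 := by positivity
    exact mul_inv_cancel_left₀ h2 _

theorem halfPlaneCoord_injOn : Set.InjOn halfPlaneCoord (sliceDomain n m) := by
  intro y hy z hz h
  refine Prod.ext (funext fun i => ?_) (funext fun j => ?_)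
  · exact cayley_injOn (sliceDomain_ne_one hy i.succ) (sliceDomain_ne_one hz i.succ)
      (congrFun (congrArg Prod.fst h) i)
  · exact boundaryCoord_injOn (sliceDomain_arg_mem hy j) (sliceDomain_arg_mem hz j)
      (congrFun (congrArg Prod.snd h) j)

theorem measurable_halfPlaneCoord :
    Measurable (halfPlaneCoord : SliceCoord n m → SliceCoord n m) := by
  have h1 : Measurable cayley := by
    unfold cayley
    fun_prop
  have h2 : Measurable boundaryCoord := by
    unfold boundaryCoord
    fun_prop
  refine Measurable.prodMk (measurable_pi_lambda _ fun i => ?_) (measurable_pi_lambda _ fun j => ?_)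
  · exact h1.comp ((measurable_pi_apply i).comp measurable_fst)
  · exact h2.comp ((measurable_pi_apply j).comp measurable_snd)

/-- The coordinate vectors of `sliceFrame` as a basis. -/
def sliceBasis (n m : ℕ) : Module.Basis (Fin (n * 2 + m)) ℝ (SliceCoord n m) :=
  ((Pi.basis fun _ : Fin n => Complex.basisOneI).prod (Pi.basisFun ℝ (Fin m))).reindex
    ((Equiv.sumCongr ((Equiv.sigmaEquivProd (Fin n) (Fin 2)).trans finProdFinEquiv)
      (Equiv.refl (Fin m))).trans finSumFinEquiv)

theorem sliceBasis_apply (a : Fin (n * 2 + m)) : sliceBasis n m a = sliceFrame a := by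
  obtain ⟨x, rfl⟩ := finSumFinEquiv.surjective a
  rcases x with x | j
  · obtain ⟨⟨i, c⟩, rfl⟩ := finProdFinEquiv.surjective x
    simp only [sliceFrame, Equiv.symm_apply_apply, sliceBasis, Module.Basis.reindex_apply]
    fin_cases c <;> simp [Pi.basis_apply]
  · simp [sliceFrame, sliceBasis]

instance : (volume : Measure (SliceCoord n m)).IsAddHaarMeasure :=
  Measure.prod.instIsAddHaarMeasure _ _

end HalfPlane

/-! ### Edge forms in half-plane coordinates -/

section DArg

open Complex Filter Topology

variable {Y : Type*} [NormedAddCommGroup Y] [NormedSpace ℝ Y] {F G : Y → ℂ} {y : Y}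

theorem dArg_congr (h : F =ᶠ[𝓝 y] G) : dArg F y = dArg G y := by
  rw [dArg, dArg, h.fderiv_eq, h.eq_of_nhds]

theorem dArg_mul (hF : DifferentiableAt ℝ F y) (hG : DifferentiableAt ℝ G y) (hF0 : F y ≠ 0)
    (hG0 : G y ≠ 0) : dArg (fun z => F z * G z) y = dArg F y + dArg G y := by
  ext v
  rw [add_apply, dArg_apply, dArg_apply, dArg_apply, fderiv_fun_mul hF hG,
    ← add_im]
  congr 1
  simp
  field_simp
  ring

theorem dArg_const_mul {c : ℂ} (hc : c ≠ 0) (hF : DifferentiableAt ℝ F y) (hF0 : F y ≠ 0) :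
    dArg (fun z => c * F z) y = dArg F y := by
  rw [dArg_mul (differentiableAt_const c) hF hc hF0]
  ext v
  simp [dArg_apply]

theorem differentiableAt_complex_div (hF : DifferentiableAt ℝ F y) (hG : DifferentiableAt ℝ G y)
    (hG0 : G y ≠ 0) : DifferentiableAt ℝ (fun z => F z / G z) y := by
  simp only [div_eq_mul_inv]
  exact hF.fun_mul (hG.fun_inv hG0)

theorem dArg_div (hF : DifferentiableAt ℝ F y) (hG : DifferentiableAt ℝ G y) (hF0 : F y ≠ 0)
    (hG0 : G y ≠ 0) : dArg (fun z => F z / G z) y = dArg F y - dArg G y := by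
  have hd : DifferentiableAt ℝ (fun z => F z / G z) y :=
    differentiableAt_complex_div hF hG hG0
  rw [eq_sub_iff_add_eq, ← dArg_mul hd hG (div_ne_zero hF0 hG0) hG0]
  refine dArg_congr ?_
  filter_upwards [hG.continuousAt.eventually_ne hG0] with z hz
  exact div_mul_cancel₀ _ hz

end DArg

section EdgeForms

open MeasureTheory Complex Topology

variable {n m : ℕ}

theorem differentiable_sliceInt (i : Fin (n + 1)) :
    Differentiable ℝ fun y : SliceCoord n m => sliceInt y i := by
  refine Fin.cases ?_ (fun i => ?_) i
  · exact differentiable_const _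
  · change Differentiable ℝ fun y : SliceCoord n m => y.1 i
    fun_prop

theorem differentiable_vertexPos (v : Fin (n + 1) ⊕ Fin (m + 1)) :
    Differentiable ℝ fun y : SliceCoord n m => vertexPos y v := by
  rcases v with i | j
  · exact differentiable_sliceInt i
  · have h : Differentiable ℝ fun y : SliceCoord n m => sliceArg y j := by
      refine Fin.cases ?_ (fun j => ?_) j
      · exact differentiable_const _
      · change Differentiable ℝ fun y : SliceCoord n m => y.2 j
        fun_prop
    exact ((ofRealCLM.differentiable.comp h).mul_const I).cexp

theorem norm_vertexPos_le {y : SliceCoord n m} (hy : y ∈ sliceDomain n m)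
    (v : Fin (n + 1) ⊕ Fin (m + 1)) : ‖vertexPos y v‖ ≤ 1 := by
  rcases v with i | j
  · exact (hy.1 i).le
  · exact (norm_exp_ofReal_mul_I _).le

theorem vertexPos_ne_sliceInt {y : SliceCoord n m} (hy : y ∈ sliceDomain n m) {k : Fin (n + 1)}
    {v : Fin (n + 1) ⊕ Fin (m + 1)} (hv : v ≠ Sum.inl k) : vertexPos y v ≠ sliceInt y k := by
  rcases v with i | j
  · exact hy.2.1.ne (by simpa using hv)
  · intro h
    have h1 := hy.1 k
    rw [← h] at h1
    exact h1.ne (norm_exp_ofReal_mul_I _)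

theorem vertexPos_ne_one {y : SliceCoord n m} (hy : y ∈ sliceDomain n m)
    {v : Fin (n + 1) ⊕ Fin (m + 1)} (hv : v ≠ Sum.inr 0) : vertexPos y v ≠ 1 := by
  rcases v with i | j
  · exact sliceDomain_ne_one hy i
  · intro h
    have hj : (0 : Fin (m + 1)) < j := Fin.pos_of_ne_zero (by simpa using hv)
    have h0 : 0 < sliceArg y j := hy.2.2.1 hj
    have h1 := hy.2.2.2 j
    have h2 : Real.cos (sliceArg y j) = 1 := by
      have := congrArg Complex.re h
      simpa [vertexPos, sliceBdry, exp_ofReal_mul_I_re] using this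
    exact h0.ne' ((Real.cos_eq_one_iff_of_lt_of_lt (by linarith) h1).1 h2)

/-- The position of the vertex `v` after the point at the vertex `k` of the first type is moved to
the origin. -/
def relativePos (k : Fin (n + 1)) (v : Fin (n + 1) ⊕ Fin (m + 1)) (y : SliceCoord n m) : ℂ :=
  diskMobius 1 (sliceInt y k) (vertexPos y v)

theorem relativePos_ne_zero {y : SliceCoord n m} (hy : y ∈ sliceDomain n m) {k : Fin (n + 1)}
    {v : Fin (n + 1) ⊕ Fin (m + 1)} (hv : v ≠ Sum.inl k) : relativePos k v y ≠ 0 := by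
  rw [relativePos, diskMobius, one_mul]
  exact div_ne_zero (sub_ne_zero.2 (vertexPos_ne_sliceInt hy hv))
    (one_sub_ne_zero (hy.1 k) (norm_vertexPos_le hy v))

theorem differentiableAt_relativePos {y : SliceCoord n m} (hy : y ∈ sliceDomain n m)
    (k : Fin (n + 1)) (v : Fin (n + 1) ⊕ Fin (m + 1)) :
    DifferentiableAt ℝ (relativePos k v) y := by
  have hp := differentiable_sliceInt (m := m) k y
  have hq := differentiable_vertexPos v y
  have hc : DifferentiableAt ℝ (fun z : SliceCoord n m => (starRingEnd ℂ) (sliceInt z k)) y :=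
    conjCLE.differentiable.differentiableAt.comp y hp
  exact (differentiableAt_complex_div (hq.fun_sub hp) ((hc.fun_mul hq).const_sub 1)
    (one_sub_ne_zero (hy.1 k) (norm_vertexPos_le hy v))).const_mul 1

/-- In half-plane coordinates the position of every vertex, apart from the vertex that is moved to
infinity, is a real-affine function. -/
theorem exists_affine_cayley {v : Fin (n + 1) ⊕ Fin (m + 1)} (hv : v ≠ Sum.inr 0) :
    ∃ (L : SliceCoord n m →L[ℝ] ℂ) (c : ℂ), ∀ y ∈ sliceDomain n m,
      cayley (vertexPos y v) = L (halfPlaneCoord y) + c := by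
  rcases v with i | j
  · refine Fin.cases ?_ (fun i => ?_) i
    · exact ⟨0, I, fun y _ => by simp [vertexPos, sliceInt, cayley]⟩
    · exact ⟨(ContinuousLinearMap.proj i).comp (ContinuousLinearMap.fst ℝ _ _), 0,
        fun y _ => by simp [vertexPos, sliceInt, halfPlaneCoord]⟩
  · have hj0 : j ≠ 0 := by simpa using hv
    obtain ⟨j, rfl⟩ := Fin.exists_succ_eq.2 hj0
    refine ⟨ofRealCLM.comp ((ContinuousLinearMap.proj j).comp (ContinuousLinearMap.snd ℝ _ _)), 0,
        fun y hy => ?_⟩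
    have h := sliceDomain_arg_mem hy j
    simpa [vertexPos, sliceBdry, sliceArg, halfPlaneCoord] using cayley_exp h.1 h.2

theorem cayley_sub_cayley {p q : ℂ} (hp : p ≠ 1) (hq : q ≠ 1) :
    cayley q - cayley p = 2 * I * (q - p) / ((1 - q) * (1 - p)) := by
  have h1 : 1 - p ≠ 0 := sub_ne_zero.2 hp.symm
  have h2 : 1 - q ≠ 0 := sub_ne_zero.2 hq.symm
  rw [cayley, cayley]
  field_simp
  ring

theorem one_sub_conj_ne_zero {p : ℂ} (hp : p ≠ 1) : 1 - (starRingEnd ℂ) p ≠ 0 := by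
  intro h
  apply hp
  have := congrArg (starRingEnd ℂ) h
  simp only [map_sub, map_one, conj_conj, map_zero] at this
  exact (sub_eq_zero.1 this).symm

theorem cayley_sub_conj_cayley {p q : ℂ} (hp : p ≠ 1) (hq : q ≠ 1) :
    cayley q - (starRingEnd ℂ) (cayley p) =
      2 * I * (1 - (starRingEnd ℂ) p * q) / ((1 - q) * (1 - (starRingEnd ℂ) p)) := by
  have h1 := one_sub_conj_ne_zero hp
  have h2 : 1 - q ≠ 0 := sub_ne_zero.2 hq.symm
  rw [cayley, cayley]
  simp only [map_div₀, map_mul, map_add, map_sub, map_one, conj_I]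
  field_simp
  ring

theorem conj_cayley_sub_I {p : ℂ} (hp : p ≠ 1) :
    (starRingEnd ℂ) (cayley p) - I = -(2 * I) / (1 - (starRingEnd ℂ) p) := by
  have h := congrArg (starRingEnd ℂ) (cayley_add_I hp)
  simpa only [map_div₀, map_mul, map_add, map_sub, map_one, conj_I, map_ofNat, mul_neg,
    ← sub_eq_add_neg] using h

theorem dArg_affine_mem {F : SliceCoord n m → ℂ} {L : SliceCoord n m →L[ℝ] ℂ} {c : ℂ}
    (hL : ∀ y ∈ sliceDomain n m, F y = L (halfPlaneCoord y) + c)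
    (hF : ∀ y ∈ sliceDomain n m, F y ≠ 0) :
    dArg F ∈ angleFormSpan (sliceDomain n m) (halfPlaneCoord (n := n) (m := m)) ∧
      ∀ y ∈ sliceDomain n m, DifferentiableAt ℝ F y := by
  have he : ∀ y ∈ sliceDomain n m, F =ᶠ[𝓝 y] fun z => L (halfPlaneCoord z) + c := fun y hy => by
    filter_upwards [(isOpen_sliceDomain n m).mem_nhds hy] with z hz using hL z hz
  refine ⟨Submodule.subset_span ⟨L, c, fun y hy => ?_, fun y hy => dArg_congr (he y hy)⟩,
    fun y hy => ?_⟩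
  · rw [← hL y hy]
    exact hF y hy
  · refine DifferentiableAt.congr_of_eventuallyEq ?_ (he y hy)
    exact (L.differentiableAt.comp y
      (hasFDerivAt_halfPlaneCoord hy).differentiableAt).add_const c

/-- In half-plane coordinates, `(q - p) / (1 - \bar p q)` is
`-((Z_q - Z_p) / (Z_q - \bar Z_p)) * ((\bar Z_p - i) / (Z_p + i))`, and the first quotient is absent
for `q = 1`, that is `Z_q = ∞`. -/
theorem dArg_relativePos_mem {k : Fin (n + 1)} {v : Fin (n + 1) ⊕ Fin (m + 1)}
    (hv : v ≠ Sum.inl k) :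
    dArg (relativePos k v) ∈
      angleFormSpan (sliceDomain n m) (halfPlaneCoord (n := n) (m := m)) := by
  have hI : (2 * I : ℂ) ≠ 0 := by simp
  obtain ⟨Lk, ck, hk⟩ := exists_affine_cayley (n := n) (m := m) (v := Sum.inl k) (by simp)
  let C : SliceCoord n m → ℂ := fun y => cayley (sliceInt y k) + I
  let D : SliceCoord n m → ℂ := fun y => (starRingEnd ℂ) (cayley (sliceInt y k)) - I
  have hC0 : ∀ y ∈ sliceDomain n m, C y ≠ 0 := fun y hy => by
    have hp := sliceDomain_ne_one hy k
    simp only [C, cayley_add_I hp]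
    exact div_ne_zero hI (sub_ne_zero.2 hp.symm)
  have hD0 : ∀ y ∈ sliceDomain n m, D y ≠ 0 := fun y hy => by
    have hp := sliceDomain_ne_one hy k
    simp only [D, conj_cayley_sub_I hp]
    exact div_ne_zero (neg_ne_zero.2 hI) (one_sub_conj_ne_zero hp)
  obtain ⟨hCm, hCd⟩ := dArg_affine_mem (F := C) (L := Lk) (c := ck + I)
    (fun y hy => by
      have := hk y hy
      simp only [C]
      rw [← add_assoc, ← this]
      rfl) hC0
  obtain ⟨hDm, hDd⟩ := dArg_affine_mem (F := D) (L := (conjCLE : ℂ →L[ℝ] ℂ).comp Lk)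
    (c := (starRingEnd ℂ) ck - I)
    (fun y hy => by
      have := congrArg (starRingEnd ℂ) (hk y hy)
      rw [map_add] at this
      simp only [D]
      refine (congrArg (· - I) this).trans ?_
      simp [add_sub_assoc]) hD0
  by_cases hv0 : v = Sum.inr 0
  · subst hv0
    refine mem_angleFormSpan_congr (Submodule.sub_mem _ hDm hCm) fun y hy => ?_
    have he : relativePos k (Sum.inr 0) =ᶠ[𝓝 y] fun z => -1 * (D z / C z) := by
      filter_upwards [(isOpen_sliceDomain n m).mem_nhds hy] with z hz
      have hp := sliceDomain_ne_one hz k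
      have h1 : 1 - sliceInt z k ≠ 0 := sub_ne_zero.2 hp.symm
      have h2 := one_sub_conj_ne_zero hp
      have hone : vertexPos z (Sum.inr 0 : Fin (n + 1) ⊕ Fin (m + 1)) = 1 := by
        simp [vertexPos, sliceBdry, sliceArg]
      simp only [C, D, relativePos, diskMobius, hone, cayley_add_I hp, conj_cayley_sub_I hp]
      field_simp
    rw [dArg_congr he, dArg_const_mul (F := fun z => D z / C z) (by simp)
      (differentiableAt_complex_div (hDd y hy) (hCd y hy) (hC0 y hy))
      (div_ne_zero (hD0 y hy) (hC0 y hy)), dArg_div (hDd y hy) (hCd y hy) (hD0 y hy) (hC0 y hy)]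
    rfl
  obtain ⟨Lv, cv, hcv⟩ := exists_affine_cayley (n := n) (m := m) hv0
  let A : SliceCoord n m → ℂ := fun y => cayley (vertexPos y v) - cayley (sliceInt y k)
  let B : SliceCoord n m → ℂ := fun y =>
    cayley (vertexPos y v) - (starRingEnd ℂ) (cayley (sliceInt y k))
  have hA0 : ∀ y ∈ sliceDomain n m, A y ≠ 0 := fun y hy =>
    sub_ne_zero.2 fun h => vertexPos_ne_sliceInt hy hv
      (cayley_injOn (vertexPos_ne_one hy hv0) (sliceDomain_ne_one hy k) h)
  have hB0 : ∀ y ∈ sliceDomain n m, B y ≠ 0 := fun y hy => by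
    have hp := sliceDomain_ne_one hy k
    have hq := vertexPos_ne_one hy hv0
    simp only [B, cayley_sub_conj_cayley hp hq]
    exact div_ne_zero (mul_ne_zero hI (one_sub_ne_zero (hy.1 k) (norm_vertexPos_le hy v)))
      (mul_ne_zero (sub_ne_zero.2 hq.symm) (one_sub_conj_ne_zero hp))
  obtain ⟨hAm, hAd⟩ := dArg_affine_mem (F := A) (L := Lv - Lk) (c := cv - ck)
    (fun y hy => by
      have h1 : cayley (sliceInt y k) = _ := hk y hy
      simp only [A, hcv y hy, h1, sub_apply]
      ring) hA0
  obtain ⟨hBm, hBd⟩ := dArg_affine_mem (F := B) (L := Lv - (conjCLE : ℂ →L[ℝ] ℂ).comp Lk)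
    (c := cv - (starRingEnd ℂ) ck)
    (fun y hy => by
      have h1 : cayley (sliceInt y k) = _ := hk y hy
      simp [B, hcv y hy, h1]
      ring) hB0
  refine mem_angleFormSpan_congr (Submodule.add_mem _ (Submodule.sub_mem _ hAm hBm)
    (Submodule.sub_mem _ hDm hCm)) fun y hy => ?_
  have he : relativePos k v =ᶠ[𝓝 y] fun z => -1 * ((A z / B z) * (D z / C z)) := by
    filter_upwards [(isOpen_sliceDomain n m).mem_nhds hy] with z hz
    have hp := sliceDomain_ne_one hz k
    have hq := vertexPos_ne_one hz hv0
    have h1 : 1 - sliceInt z k ≠ 0 := sub_ne_zero.2 hp.symm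
    have h2 := one_sub_conj_ne_zero hp
    have h3 : 1 - vertexPos z v ≠ 0 := sub_ne_zero.2 hq.symm
    have h4 := one_sub_ne_zero (hz.1 k) (norm_vertexPos_le hz v)
    simp only [A, B, C, D, relativePos, diskMobius, cayley_add_I hp, conj_cayley_sub_I hp,
      cayley_sub_cayley hp hq, cayley_sub_conj_cayley hp hq]
    field_simp
  have hABd := differentiableAt_complex_div (hAd y hy) (hBd y hy) (hB0 y hy)
  have hDCd := differentiableAt_complex_div (hDd y hy) (hCd y hy) (hC0 y hy)
  have hAB0 := div_ne_zero (hA0 y hy) (hB0 y hy)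
  have hDC0 := div_ne_zero (hD0 y hy) (hC0 y hy)
  rw [dArg_congr he, dArg_const_mul (by simp) (hABd.fun_mul hDCd) (mul_ne_zero hAB0 hDC0),
    dArg_mul hABd hDCd hAB0 hDC0, dArg_div (hAd y hy) (hBd y hy) (hA0 y hy) (hB0 y hy),
    dArg_div (hDd y hy) (hCd y hy) (hD0 y hy) (hC0 y hy)]
  rfl

/-- The edge form `∑ⱼ αⱼ dφ(p_k, p_v; q_j)` of an edge from `k` to `v`. -/
def vertexForm (α : Fin (m + 1) → ℝ) (k : Fin (n + 1)) (v : Fin (n + 1) ⊕ Fin (m + 1))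
    (y : SliceCoord n m) : SliceCoord n m →L[ℝ] ℝ :=
  ∑ j, α j • dArg (fun z => angleRatio (sliceInt z k) (vertexPos z v) (sliceBdry z j)) y

theorem vertexForm_eq (α : Fin (m + 1) → ℝ) {k : Fin (n + 1)} {v : Fin (n + 1) ⊕ Fin (m + 1)}
    (hv : v ≠ Sum.inl k) {y : SliceCoord n m} (hy : y ∈ sliceDomain n m) :
    vertexForm α k v y = (∑ j, α j) • dArg (relativePos k v) y -
      ∑ j, α j • dArg (relativePos k (Sum.inr j)) y := by
  rw [vertexForm, Finset.sum_smul, ← Finset.sum_sub_distrib]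
  refine Finset.sum_congr rfl fun j _ => ?_
  rw [← smul_sub]
  congr 1
  exact dArg_div (F := relativePos k v) (G := relativePos k (Sum.inr j))
    (differentiableAt_relativePos hy k v) (differentiableAt_relativePos hy k _)
    (relativePos_ne_zero hy hv) (relativePos_ne_zero hy (by simp))

theorem vertexForm_mem (α : Fin (m + 1) → ℝ) {k : Fin (n + 1)} {v : Fin (n + 1) ⊕ Fin (m + 1)}
    (hv : v ≠ Sum.inl k) :
    vertexForm α k v ∈ angleFormSpan (sliceDomain n m) (halfPlaneCoord (n := n) (m := m)) := by
  refine mem_angleFormSpan_congr (η := (∑ j, α j) • dArg (relativePos k v) -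
    ∑ j, α j • dArg (relativePos k (Sum.inr j))) (Submodule.sub_mem _
    (Submodule.smul_mem _ _ (dArg_relativePos_mem hv)) (Submodule.sum_mem _ fun j _ =>
      Submodule.smul_mem _ _ (dArg_relativePos_mem (by simp)))) fun y hy => ?_
  rw [vertexForm_eq α hv hy]
  simp

theorem integrableOn_weightDensity (Γ : AdmissibleGraph (n + 1) (m + 1)) (α : Fin (m + 1) → ℝ) :
    IntegrableOn (weightDensity Γ α) (sliceDomain n m) := by
  have h := integrableOn_det_of_mem_angleFormSpan volume (sliceBasis n m)
    (isOpen_sliceDomain n m).measurableSet (fun y hy => hasFDerivAt_halfPlaneCoord hy)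
    (fun y hy => halfPlaneCoordDeriv_surjective hy) halfPlaneCoord_injOn
    measurable_halfPlaneCoord
    (fun a => edgeForm Γ α (finSigmaFinEquiv.symm (finCongr (sum_star_eq Γ) a)))
    (fun a => vertexForm_mem α (Γ.target_ne _ _))
  simp only [sliceBasis_apply] at h
  exact h

end EdgeForms

/-! ### Independence of the weights `α` -/

section Independence

open MeasureTheory

variable {𝕜 : Type*} [RCLike 𝕜]

/-- A sum over all maps `τ` of a multilinear expression in vectors `η e (τ e)` does not change when
each `η e` is translated by a vector, if the coefficients have vanishing partial sums in every
direction `e`: a summand that involves a translation `θ e` does not depend on `τ e` otherwise. -/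
theorem sum_multilinear_add_eq {ι Z : Type*} [Fintype ι] [DecidableEq ι] [AddCommGroup Z]
    [Module ℝ Z] {W : ι → Type*} [∀ i, Fintype (W i)]
    (D : MultilinearMap ℝ (fun _ : ι => Z) ℝ) (X : (∀ e, W e) → 𝕜)
    (hX : ∀ e τ, ∑ v, X (Function.update τ e v) = 0) (η : ∀ e, W e → Z) (θ : ι → Z) :
    ∑ τ, (D (fun e => η e (τ e) + θ e) : 𝕜) * X τ = ∑ τ, (D (fun e => η e (τ e)) : 𝕜) * X τ := by
  have hexp : ∀ τ : ∀ e, W e, (D (fun e => η e (τ e) + θ e) : 𝕜) * X τ =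
      ∑ S : Finset ι, (D (S.piecewise (fun e => η e (τ e)) θ) : 𝕜) * X τ := by
    intro τ
    have h : (fun e => η e (τ e) + θ e) = (fun e => η e (τ e)) + θ := rfl
    rw [h, D.map_add_univ]
    push_cast
    rw [Finset.sum_mul]
  rw [Finset.sum_congr rfl fun τ _ => hexp τ, Finset.sum_comm,
    Finset.sum_eq_single Finset.univ]
  · simp
  · intro S _ hS
    obtain ⟨e, he⟩ : ∃ e, e ∉ S := by
      by_contra! h
      exact hS (Finset.eq_univ_iff_forall.2 h)
    refine sum_pi_eq_zero_of_sum_update e _ fun τ => ?_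
    have hconst : ∀ v : W e, S.piecewise (fun i => η i (Function.update τ e v i)) θ =
        S.piecewise (fun i => η i (τ i)) θ := by
      intro v
      refine Finset.piecewise_congr S (fun i hi => ?_) (fun i _ => rfl)
      have : i ≠ e := fun h => he (h ▸ hi)
      rw [Function.update_of_ne this]
    simp only [hconst]
    rw [← Finset.mul_sum, hX, mul_zero]
  · intro h
    exact absurd (Finset.mem_univ _) h

variable {d n m : ℕ}

/-- The graph with a given family of targets. -/
def graphOfTargets (s : Fin (n + 1) → ℕ) (hs : ∑ k, s k + 3 = 2 * (n + 1) + (m + 1))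
    (τ : ∀ e : Σ k, Fin (s k), {v : Fin (n + 1) ⊕ Fin (m + 1) // v ≠ Sum.inl e.1})
    (hτ : ∀ k, Function.Injective fun a => (τ ⟨k, a⟩).1) : AdmissibleGraph (n + 1) (m + 1) where
  star := s
  target k a := (τ ⟨k, a⟩).1
  target_ne k a := (τ ⟨k, a⟩).2
  target_injective := hτ
  card_edges := hs

/-- The graphs with a fixed number of edges at every start correspond to the families of targets
without multiple edges. A term `G τ` that vanishes at multiple edges can be summed over all
families without loops. -/
theorem sum_filter_star_eq (s : Fin (n + 1) → ℕ)
    (hs : ∑ k, s k + 3 = 2 * (n + 1) + (m + 1)) (g : AdmissibleGraph (n + 1) (m + 1) → 𝕜)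
    (G : (∀ e : Σ k, Fin (s k), {v : Fin (n + 1) ⊕ Fin (m + 1) // v ≠ Sum.inl e.1}) → 𝕜)
    (hg : ∀ τ hτ, g (graphOfTargets s hs τ hτ) = G τ)
    (hG : ∀ τ, (¬ ∀ k, Function.Injective fun a => (τ ⟨k, a⟩).1) → G τ = 0) :
    ∑ Γ with Γ.star = s, g Γ = ∑ τ, G τ := by
  classical
  have h1 : ∑ τ with (∀ k, Function.Injective fun a => (τ ⟨k, a⟩).1), G τ = ∑ τ, G τ := by
    refine Finset.sum_filter_of_ne fun τ _ h => ?_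
    by_contra hn
    exact h (hG τ hn)
  rw [← h1]
  symm
  refine Finset.sum_bij (fun τ hτ => graphOfTargets s hs τ (Finset.mem_filter.1 hτ).2)
    (fun τ hτ => Finset.mem_filter.2 ⟨Finset.mem_univ _, rfl⟩) (fun τ hτ τ' hτ' h => ?_)
    (fun Γ hΓ => ?_) (fun τ hτ => (hg τ _).symm)
  · have ht := eq_of_heq (AdmissibleGraph.mk.inj h).2
    funext e
    exact Subtype.ext (congrFun (congrFun ht e.1) e.2)
  · obtain rfl := (Finset.mem_filter.1 hΓ).2
    exact ⟨fun e => ⟨Γ.target e.1 e.2, Γ.target_ne e.1 e.2⟩,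
      Finset.mem_filter.2 ⟨Finset.mem_univ _, fun k => Γ.target_injective k⟩, rfl⟩

variable {Ω : (Fin d → ℝ) [⋀^Fin d]→L[ℝ] ℝ} {γ : Fin (n + 1) → Polyvector d 𝕜}
  {f : Fin (m + 1) → (Fin d → ℝ) → 𝕜}

/-- The angle forms for different `α` with equal sum differ by a form that does not depend on the
end of the edge. -/
theorem vertexForm_eq_add {α α' : Fin (m + 1) → ℝ} (hα : ∑ j, α j = ∑ j, α' j)
    {y : SliceCoord n m} (hy : y ∈ sliceDomain n m) (k : Fin (n + 1)) :
    ∃ θ : SliceCoord n m →L[ℝ] ℝ, ∀ v : Fin (n + 1) ⊕ Fin (m + 1), v ≠ Sum.inl k →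
      vertexForm α k v y = vertexForm α' k v y + θ := by
  refine ⟨(∑ j, α' j • dArg (relativePos k (Sum.inr j)) y) -
    ∑ j, α j • dArg (relativePos k (Sum.inr j)) y, fun v hv => ?_⟩
  rw [vertexForm_eq α hv hy, vertexForm_eq α' hv hy, hα]
  abel

/-- The independence of `α` at a single configuration `y`. The coefficient `C` stands for the
factors that depend on the numbers of edges at the starts only, such as the Koszul signs. -/
theorem sum_weightDensity_mul_integral_graphOperator (hΩ : Ω ≠ 0) (hγ : ∀ i, (γ i).IsDivFree Ω)
    (hf : ∀ j, ContDiff ℝ ∞ (f j)) (hfc : ∀ j, HasCompactSupport (f j))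
    {α α' : Fin (m + 1) → ℝ} (hα : ∑ j, α j = ∑ j, α' j) {y : SliceCoord n m}
    (hy : y ∈ sliceDomain n m) (C : (Fin (n + 1) → ℕ) → 𝕜) :
    ∑ Γ : AdmissibleGraph (n + 1) (m + 1), (weightDensity Γ α y : 𝕜) *
        (C Γ.star * ∫ x, graphOperator Γ γ f x) =
      ∑ Γ : AdmissibleGraph (n + 1) (m + 1), (weightDensity Γ α' y : 𝕜) *
        (C Γ.star * ∫ x, graphOperator Γ γ f x) := by
  classical
  rw [← Finset.sum_fiberwise_of_maps_to (t := Finset.univ.image AdmissibleGraph.star)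
      (g := AdmissibleGraph.star) (fun Γ _ => Finset.mem_image_of_mem _ (Finset.mem_univ Γ)),
    ← Finset.sum_fiberwise_of_maps_to (t := Finset.univ.image AdmissibleGraph.star)
      (g := AdmissibleGraph.star) (fun Γ _ => Finset.mem_image_of_mem _ (Finset.mem_univ Γ))]
  refine Finset.sum_congr rfl fun s hs => ?_
  obtain ⟨Γ₀, -, rfl⟩ := Finset.mem_image.1 hs
  have hs := Γ₀.card_edges
  generalize Γ₀.star = s at hs
  have hs' : n * 2 + m = ∑ k, s k := by omega
  let σ : Fin (n * 2 + m) ≃ Σ k, Fin (s k) := (finCongr hs').trans finSigmaFinEquiv.symm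
  let D : MultilinearMap ℝ (fun _ : Σ k, Fin (s k) => Fin (n * 2 + m) → ℝ) ℝ :=
    (Matrix.detRowAlternating (R := ℝ)).toMultilinearMap.domDomCongr σ
  let X : (∀ e : Σ k, Fin (s k), {v : Fin (n + 1) ⊕ Fin (m + 1) // v ≠ Sum.inl e.1}) → 𝕜 :=
    fun τ => ∫ x, targetOperator s (fun e => (τ e).1) γ f x
  have hX : ∀ e τ, ∑ v, X (Function.update τ e v) = 0 := by
    intro e τ
    have h := sum_integral_targetOperator_update hΩ hγ hf hfc 0 (fun e => (τ e).1) e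
    rw [Finset.sum_subtype (p := fun v => v ≠ Sum.inl e.1) _ (by simp)] at h
    rw [← h]
    refine Finset.sum_congr rfl fun v _ => ?_
    simp only [X]
    congr 2
    funext x
    congr 1
    funext e'
    by_cases he : e' = e
    · subst he
      simp
    · simp [he]
  have hXinj : ∀ τ, (¬ ∀ k, Function.Injective fun a => (τ ⟨k, a⟩).1) → X τ = 0 := by
    intro τ hτ
    obtain ⟨k, hk⟩ := not_forall.1 hτ
    rw [Function.not_injective_iff] at hk
    obtain ⟨a, b, hab, hne⟩ := hk
    simp only [X]
    rw [targetOperator_eq_zero_of_multiple hf (fun e => (τ e).1) hne hab]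
    simp
  have hsum : ∀ α : Fin (m + 1) → ℝ, ∑ Γ with Γ.star = s, (weightDensity Γ α y : 𝕜) *
      (C Γ.star * ∫ x, graphOperator Γ γ f x) =
      C s * ∑ τ, (D (fun e b => vertexForm α e.1 (τ e).1 y (sliceFrame b)) : 𝕜) * X τ := by
    intro α
    rw [Finset.mul_sum]
    refine sum_filter_star_eq s hs _ _ (fun τ hτ => ?_) (fun τ hτ => ?_)
    · rw [graphOperator_eq_targetOperator, mul_left_comm]
      rfl
    · rw [hXinj τ hτ, mul_zero, mul_zero]
  rw [hsum, hsum]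
  congr 1
  choose θ hθ using fun k => vertexForm_eq_add hα hy k
  rw [← sum_multilinear_add_eq D X hX (fun e v b => vertexForm α' e.1 v.1 y (sliceFrame b))
    (fun e b => θ e.1 (sliceFrame b))]
  refine Finset.sum_congr rfl fun τ _ => ?_
  congr 3
  funext e b
  rw [hθ e.1 _ (τ e).2]
  rfl

theorem integrable_graphOperator (hf : ∀ j, ContDiff ℝ ∞ (f j))
    (hfc : ∀ j, HasCompactSupport (f j)) (γ : Fin (n + 1) → Polyvector d 𝕜)
    (Γ : AdmissibleGraph (n + 1) (m + 1)) : Integrable (graphOperator Γ γ f) := by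
  rw [graphOperator_eq_targetOperator]
  exact integrable_of_contDiff_of_hasCompactSupport (contDiff_targetOperator hf _)
    (hasCompactSupport_targetOperator hfc 0 _)

theorem integrable_skewGraphOperator (hf : ∀ j, ContDiff ℝ ∞ (f j))
    (hfc : ∀ j, HasCompactSupport (f j)) (γ : Fin (n + 1) → Polyvector d 𝕜)
    (Γ : AdmissibleGraph (n + 1) (m + 1)) : Integrable (skewGraphOperator Γ γ f) :=
  (integrable_finsetSum _ fun _ _ => (integrable_graphOperator hf hfc _ Γ).const_mul _).const_mul _

theorem integrable_kontsevichOperator (hf : ∀ j, ContDiff ℝ ∞ (f j))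
    (hfc : ∀ j, HasCompactSupport (f j)) (γ : Fin (n + 1) → Polyvector d 𝕜)
    (α : Fin (m + 1) → ℝ) : Integrable (kontsevichOperator α γ f) :=
  integrable_finsetSum _ fun Γ _ => (integrable_skewGraphOperator hf hfc γ Γ).const_mul _

/-- The integral over `ℝ^d` and the integral over the configuration space are interchanged. -/
theorem integral_kontsevichOperator (hf : ∀ j, ContDiff ℝ ∞ (f j))
    (hfc : ∀ j, HasCompactSupport (f j)) (γ : Fin (n + 1) → Polyvector d 𝕜)
    (α : Fin (m + 1) → ℝ) :
    ∫ x, kontsevichOperator α γ f x = (((2 * Real.pi) ^ (2 * (n + 1) + (m + 1) - 2))⁻¹ : ℝ) *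
      ∫ y in sliceDomain n m, ∑ σ : Equiv.Perm (Fin (n + 1)),
        ∑ Γ : AdmissibleGraph (n + 1) (m + 1), (weightDensity Γ α y : 𝕜) *
          (((∏ k, ((Γ.star k).factorial : ℝ)⁻¹ : ℝ) * (((n + 1).factorial : 𝕜)⁻¹ *
            (koszulSign Γ.star σ : 𝕜))) * ∫ x, graphOperator Γ (fun i => γ (σ i)) f x) := by
  have hskew : ∀ Γ : AdmissibleGraph (n + 1) (m + 1), ∫ x, skewGraphOperator Γ γ f x =
      ((n + 1).factorial : 𝕜)⁻¹ * ∑ σ : Equiv.Perm (Fin (n + 1)), (koszulSign Γ.star σ : 𝕜) *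
        ∫ x, graphOperator Γ (fun i => γ (σ i)) f x := by
    intro Γ
    simp only [skewGraphOperator]
    rw [integral_const_mul, integral_finsetSum _ fun σ _ =>
      (integrable_graphOperator hf hfc _ Γ).const_mul _]
    simp only [integral_const_mul]
  have hwd : ∀ (Γ : AdmissibleGraph (n + 1) (m + 1)), IntegrableOn
      (fun y => (weightDensity Γ α y : 𝕜)) (sliceDomain n m) := fun Γ =>
    (integrableOn_weightDensity Γ α).ofReal
  simp only [kontsevichOperator]
  rw [integral_finsetSum _ fun Γ _ => (integrable_skewGraphOperator hf hfc γ Γ).const_mul _,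
    integral_finsetSum _ fun σ _ => integrable_finsetSum _ fun Γ _ => (hwd Γ).mul_const _]
  simp only [integral_const_mul]
  rw [Finset.sum_congr rfl fun (σ : Equiv.Perm (Fin (n + 1))) _ =>
    integral_finsetSum _ fun Γ _ => (hwd Γ).mul_const _, Finset.sum_comm, Finset.mul_sum]
  refine Finset.sum_congr rfl fun Γ _ => ?_
  simp only [integral_mul_const, integral_ofReal, weight, hskew, Finset.mul_sum]
  refine Finset.sum_congr rfl fun σ _ => ?_
  push_cast
  ring

end Independence

end CyclicFormality

end

theorem mainTheorem6 {𝕜 : Type*} [RCLike 𝕜] (d n m : ℕ)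
    (Ω : (Fin d → ℝ) [⋀^Fin d]→L[ℝ] ℝ) (hΩ : Ω ≠ 0)
    (γ : Fin (n + 1) → CyclicFormality.Polyvector d 𝕜)
    (hγ : ∀ i, (γ i).IsDivFree Ω)
    (f : Fin (m + 1) → (Fin d → ℝ) → 𝕜)
    (hf : ∀ j, ContDiff ℝ ∞ (f j)) (hfc : ∀ j, HasCompactSupport (f j)) :
    (∀ (α : Fin (m + 1) → ℝ) (Γ : CyclicFormality.AdmissibleGraph (n + 1) (m + 1)),
      MeasureTheory.IntegrableOn (CyclicFormality.weightDensity Γ α)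
        (CyclicFormality.sliceDomain n m)) ∧
    (∀ α : Fin (m + 1) → ℝ,
      MeasureTheory.Integrable (CyclicFormality.kontsevichOperator α γ f)) ∧
    ∀ α α' : Fin (m + 1) → ℝ, ∑ j, α j = ∑ j, α' j →
      CyclicFormality.integralForm Ω (CyclicFormality.kontsevichOperator α γ f) =
        CyclicFormality.integralForm Ω (CyclicFormality.kontsevichOperator α' γ f) := by
  refine ⟨fun α Γ => CyclicFormality.integrableOn_weightDensity Γ α,
    fun α => CyclicFormality.integrable_kontsevichOperator hf hfc γ α, fun α α' hα => ?_⟩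
  rw [CyclicFormality.integralForm, CyclicFormality.integralForm,
    CyclicFormality.integral_kontsevichOperator hf hfc,
    CyclicFormality.integral_kontsevichOperator hf hfc]
  congr 2
  refine MeasureTheory.setIntegral_congr_fun
    (CyclicFormality.isOpen_sliceDomain n m).measurableSet fun y hy => ?_
  refine Finset.sum_congr rfl fun σ _ => ?_
  exact CyclicFormality.sum_weightDensity_mul_integral_graphOperator hΩ (fun i => hγ (σ i)) hf hfc
    hα hy (fun s => ((∏ k, ((s k).factorial : ℝ)⁻¹ : ℝ) : 𝕜) * (((n + 1).factorial : 𝕜)⁻¹ *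
      (CyclicFormality.koszulSign s σ : 𝕜)))
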